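/- **Theorem 1.** The satisfiability problem $\mathrm{trSAT}[\mathcal{T}_{\mathit{udec}}]$ is undecidable: no algorithm takes (a finite description of) a transformer encoder $T\in\mathcal{T}_{\mathit{udec}}$ over a finite non-empty alphabet $\Sigma$ and decides whether there is a non-empty word $w\in\Sigma^+$ with $T(w)=1$. Here a *ReLU-FNN* is a feed-forward neural network with at least one layer, with rational weights and biases, with the activation $\mathrm{relu}(x)=\max(0,x)$ in all layers except the last one, and with an affine last layer. An encoder $T\in\mathcal{T}_{\mathit{udec}}$ over $\Sigma=\{a_1,\dots,a_m\}$ consists of the positional embedding $\mathit{emb}$, of finitely many layers, and of an output function, as follows. * *Embedding.* Numbering the positions of a word from $0$, $\mathit{emb}(a_k,0)=(1,1,0,0,k)$ and $\mathit{emb}(a_k,i)=(0,1,i,\sum_{j=0}^{i}j,k)$ for $i\ge 1$. A word $w=b_0\cdots b_{n-1}$ is turned into the sequence $\mathit{emb}(b_0,0),\dots,\mathit{emb}(b_{n-1},n-1)$ of vectors of $\mathbb{R}^5$. * *Layers.* A layer on $\mathbb{R}^d$ has finitely many attention heads, each given by rational matrices $Q,K,W$ with $d$ columns ($Q$ and $K$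 having equally many rows) and a ReLU-FNN $N:\mathbb{R}\to\mathbb{R}$. It also has a ReLU-FNN $\mathit{comb}$ with values in some $\mathbb{R}^{d'}$. For an input sequence $x_0,\dots,x_{n-1}$, such a head yields at position $p$ the vector $y_p=\sum_{i=0}^{n-1}\mathrm{hardmax}(i,s_0,\dots,s_{n-1})\,Wx_i$, where $s_i=N(\langle Qx_p,Kx_i\rangle)$. The layer replaces $x_p$ by $\mathit{comb}(x_p,y_p^{1},\dots,y_p^{h})$, where $y_p^1,\dots,y_p^h$ are the outputs of its heads at position $p$. Here $\mathrm{hardmax}(i,s_0,\dots,s_{n-1})=\frac1c$ if $s_i$ is maximal among $s_0,\dots,s_{n-1}$ and exactly $c$ positions carry this maximal value, and it is $0$ otherwise. * *Output.* $T(w)$ is the value of a ReLU-FNN $\mathit{out}:\mathbb{R}^{d_L}\to\mathbb{R}$ on the vector at the last position after all layers, where $\mathbb{R}^{d_L}$ is the space of vectors produced by the last layer. -/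

import Mathlib

namespace TE

/-! ### Transformer encoders

A vector of `ℝ^d` is a list of `d` real numbers, a linear map `ℝ^d → ℝ^e` is the list of the `e`
rows (each of length `d`) of its matrix. Positions of a word or a sequence are numbered from `0`. -/

abbrev Vec := List ℝ

/-- The scalar product. -/
noncomputable def dot (u v : Vec) : ℝ := (List.zipWith (fun a b => a * b) u v).sum

/-- The matrix-vector product `M x`, the matrix being given by its rows. -/
noncomputable def mulVec (M : List Vec) (x : Vec) : Vec := M.map fun r => dot r x

/-- An attention head: a scoring function, and a pooling function given by a normalisation
`norm i (s₁, …, sₙ)` and a matrix `W`. -/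
structure AttentionHead where
  score : Vec → Vec → ℝ
  norm : ℕ → List ℝ → ℝ
  W : List Vec

/-- The pooling function `(x₁, …, xₙ, s₁, …, sₙ) ↦ ∑ᵢ norm i (s₁, …, sₙ) • (W xᵢ)`,
written coordinate by coordinate. -/
noncomputable def AttentionHead.pool (h : AttentionHead) (xs : List Vec) (s : List ℝ) : Vec :=
  h.W.map fun r => ∑ i ∈ Finset.range xs.length, h.norm i s * dot r (xs.getD i [])

/-- The output of the head for the sequence `xs` at a position that carries the vector `x`. -/
noncomputable def AttentionHead.attend (h : AttentionHead) (xs : List Vec) (x : Vec) : Vec :=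
  h.pool xs (xs.map fun y => h.score x y)

/-- A layer: attention heads, and a combination function that takes the vector at the current
position and the list of the outputs of the heads. -/
structure EncoderLayer where
  heads : List AttentionHead
  comb : Vec → List Vec → Vec

noncomputable def EncoderLayer.apply (l : EncoderLayer) (xs : List Vec) : List Vec :=
  xs.map fun x => l.comb x (l.heads.map fun h => h.attend xs x)

/-- A transformer encoder over the alphabet `α`. -/
structure Encoder (α : Type) where
  emb : α → ℕ → Vec
  layers : List EncoderLayer
  out : Vec → ℝ

/-- The embedded word. -/
def Encoder.embed {α : Type} (T : Encoder α) (w : List α) : List Vec :=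
  w.mapIdx fun i a => T.emb a i

/-- The value `T(w)`: the output function applied to the vector at the last position, after all
layers (for a non-empty word `w`; the value for the empty word is irrelevant). -/
noncomputable def Encoder.eval {α : Type} (T : Encoder α) (w : List α) : ℝ :=
  T.out ((T.layers.foldl (fun xs l => l.apply xs) (T.embed w)).getLastD [])

/-- Some non-empty word is accepted, i.e. has the value `1`. -/
def Encoder.Satisfiable {α : Type} (T : Encoder α) : Prop :=
  ∃ w : List α, w ≠ [] ∧ T.eval w = 1

/-! ### Components: hardmax, the sum-type positional embedding, ReLU networks -/

/-- `hardmax i (s₁, …, sₙ)` is `1 / m` if the entry at position `i` is maximal and `m` positions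
carry this maximal value, and it is `0` otherwise. -/
noncomputable def hardmax (i : ℕ) (s : List ℝ) : ℝ :=
  if ∀ y ∈ s, y ≤ s.getD i 0 then 1 / (s.count (s.getD i 0) : ℝ) else 0

/-- The positional embedding; the letters `a₁, …, aₘ` are the elements `0, …, m - 1` of `Fin m`. -/
noncomputable def sumEmb {m : ℕ} (a : Fin m) (i : ℕ) : Vec :=
  if i = 0 then [1, 1, 0, 0, (a : ℝ) + 1]
  else [0, 1, (i : ℝ), ∑ j ∈ Finset.range (i + 1), (j : ℝ), (a : ℝ) + 1]

noncomputable def relu (x : ℝ) : ℝ := max 0 x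

/-! ### Finite descriptions

The parameters are rational numbers, so that an encoder of the class is a finite object and can
be the input of an algorithm. All codes are built from numbers by pairs and lists and hence have
the standard effective coding. -/

/-- `(p, q)` stands for the rational number `p / (q + 1)`. -/
abbrev RatCode := ℤ × ℕ

noncomputable def RatCode.val (c : RatCode) : ℝ := (c.1 : ℝ) / ((c.2 : ℝ) + 1)

noncomputable def vecVal (v : List RatCode) : Vec := v.map RatCode.val

abbrev MatCode := List (List RatCode)

noncomputable def matVal (M : MatCode) : List Vec := M.map vecVal

/-- A neuron: its bias and its list of weights. -/
abbrev NeuronCode := RatCode × List RatCode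

/-- A feed-forward network: a list of layers, each a list of neurons. -/
abbrev FNNCode := List (List NeuronCode)

noncomputable def affine (l : List NeuronCode) (x : Vec) : Vec :=
  l.map fun v => RatCode.val v.1 + dot (vecVal v.2) x

/-- The function of a network: ReLU activation in every layer but the last (output) layer, which
is affine. -/
noncomputable def fnnEval : FNNCode → Vec → Vec
  | [], x => x
  | [l], x => affine l x
  | l :: l' :: N, x => fnnEval (l' :: N) ((affine l x).map relu)

/-- `((Q, K, N), W)`. -/
abbrev HeadCode := (MatCode × MatCode × FNNCode) × MatCode

/-- The head with scoring `N(⟨Q x, K y⟩)`, normalisation `hardmax` and pooling matrix `W`. -/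
noncomputable def headVal (h : HeadCode) : AttentionHead where
  score x y := (fnnEval h.1.2.2 [dot (mulVec (matVal h.1.1) x) (mulVec (matVal h.1.2.1) y)]).headD 0
  norm := hardmax
  W := matVal h.2

/-- The heads, and the network computing the combination. -/
abbrev LayerCode := List HeadCode × FNNCode

/-- The combination network is applied to the concatenation of all its arguments. -/
noncomputable def layerVal (l : LayerCode) : EncoderLayer where
  heads := l.1.map headVal
  comb x ys := fnnEval l.2 (x ++ ys.flatten)

/-- The size of the alphabet, the layers, and the output network. -/
abbrev UdecCode := ℕ × List LayerCode × FNNCode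

noncomputable def encoderVal (c : UdecCode) : Encoder (Fin c.1) where
  emb := sumEmb
  layers := c.2.1.map layerVal
  out x := (fnnEval c.2.2 x).headD 0

/-! ### Well-formedness: all dimensions match -/

/-- An `e × d` matrix. -/
def MatWF (e d : ℕ) (M : MatCode) : Prop := M.length = e ∧ ∀ r ∈ M, r.length = d

/-- A network (with at least one layer) from `ℝ^d` to `ℝ^e`. -/
def FNNWF : ℕ → FNNCode → ℕ → Prop
  | _, [], _ => False
  | d, [l], e => (∀ v ∈ l, v.2.length = d) ∧ l.length = e
  | d, l :: l' :: N, e => (∀ v ∈ l, v.2.length = d) ∧ FNNWF l.length (l' :: N) e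

/-- A head on `ℝ^d`: `Q` and `K` map `ℝ^d` to the same `ℝ^p`, the scoring network maps `ℝ` to
`ℝ`, and `W` has `d` columns. -/
def HeadWF (d : ℕ) (h : HeadCode) : Prop :=
  (∃ p, MatWF p d h.1.1 ∧ MatWF p d h.1.2.1) ∧ FNNWF 1 h.1.2.2 1 ∧ MatWF h.2.length d h.2

/-- A stack of layers from `ℝ^d` to `ℝ^e`. -/
def LayersWF : ℕ → List LayerCode → ℕ → Prop
  | d, [], e => d = e
  | d, l :: L, e => (∀ h ∈ l.1, HeadWF d h) ∧
      ∃ d', FNNWF (d + (l.1.map fun h => h.2.length).sum) l.2 d' ∧ LayersWF d' L e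

/-- The code of a transformer encoder over a non-empty alphabet, with all dimensions matching. -/
def UdecWF (c : UdecCode) : Prop :=
  0 < c.1 ∧ ∃ d, LayersWF 5 c.2.1 d ∧ FNNWF d c.2.2 1

end TE

/-! The halting problem is reduced to satisfiability. A partial recursive function is computed by a
nondeterministic counter program (`computes_of_partrec'`), so halting on `n` means that some run
succeeds. A program compiles to a finite list of transitions (`Prog.run_of_rel`, `Prog.rel_of_run`),
and with a token for the current state it becomes a net whose letters add integer vectors
(`exists_net_of_prog`). A word is then a successful run iff all its prefix sums are nonnegative,
those subject to a zero test vanish, and the final counters end at zero.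

An encoder can check these conditions in a given word. Hardmax attention with score `-relu (q - p)`
at position `p` averages uniformly over the positions `q ≤ p`, and the mean of the effects is the
prefix sum divided by `p + 1`, with the same sign and the same zeros (`prefixHead_attend`). A ReLU
network turns violations into positive penalties, a second head averages the penalties over the
word, and the output is `1` minus nonnegative terms. Hence the value is `1` exactly on successful
runs (`Net.eval_code_eq_one_iff`).

The net is fixed by the program; `n` enters the code as a single weight, so the reduction is
computable (`Net.primrec_code`). -/

namespace TE

/-! ### Counter programs -/

/-- Elementary actions on a store of counters. -/
inductive Act
  | inc (r : ℕ)
  | dec (r : ℕ)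
  | test (r : ℕ)
  | nop

/-- `test r` and `dec r` block unless counter `r` is zero, respectively positive. -/
def Act.rel : Act → (ℕ → ℕ) → (ℕ → ℕ) → Prop
  | .inc r, c, c' => c' = Function.update c r (c r + 1)
  | .dec r, c, c' => 0 < c r ∧ c' = Function.update c r (c r - 1)
  | .test r, c, c' => c r = 0 ∧ c' = c
  | .nop, c, c' => c' = c

/-- Nondeterministic structured counter programs. -/
inductive Prog
  | act (a : Act)
  | seq (p q : Prog)
  | star (p : Prog)

/-- A blocked action has no successor store, and a star may stop after any number of rounds; a wrong
guess therefore leads to no final store and needs no further treatment. -/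
def Prog.rel : Prog → (ℕ → ℕ) → (ℕ → ℕ) → Prop
  | .act a, c, c' => a.rel c c'
  | .seq p q, c, c' => ∃ d, p.rel c d ∧ q.rel d c'
  | .star p, c, c' => Relation.ReflTransGen p.rel c c'

open Function

/-- Along a deterministic sequence of stores, the only freedom of a star is the number `N` of
rounds. -/
theorem reflTransGen_iff_of_step {α : Type*} {B : α → α → Prop} {s : ℕ → α} {P : ℕ → Prop}
    (h : ∀ i c', B (s i) c' ↔ P i ∧ c' = s (i + 1)) (c' : α) :
    Relation.ReflTransGen B (s 0) c' ↔ ∃ N, (∀ i < N, P i) ∧ c' = s N := by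
  constructor
  · intro H
    induction H with
    | refl => exact ⟨0, by simp, rfl⟩
    | tail _ hb ih =>
      obtain ⟨N, hN, rfl⟩ := ih
      obtain ⟨hP, rfl⟩ := (h _ _).1 hb
      refine ⟨N + 1, fun i hi => ?_, rfl⟩
      rcases Nat.lt_succ_iff_lt_or_eq.1 hi with hi | rfl
      · exact hN i hi
      · exact hP
  · rintro ⟨N, hN, rfl⟩
    induction N with
    | zero => exact .refl
    | succ N ih =>
      exact (ih fun i hi => hN i (by omega)).tail ((h _ _).2 ⟨hN N (by omega), rfl⟩)

/-- A loop that runs until counter `r` is zero, along a known sequence of stores. -/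
theorem Prog.rel_loop {p : Prog} {r : ℕ} {s : ℕ → ℕ → ℕ} (M : ℕ)
    (h : ∀ i c', p.rel (s i) c' ↔ i < M ∧ c' = s (i + 1))
    (h0 : ∀ i ≤ M, s i r = 0 ↔ i = M) (c' : ℕ → ℕ) :
    (Prog.seq (.star p) (.act (.test r))).rel (s 0) c' ↔ c' = s M := by
  simp only [Prog.rel, Act.rel, reflTransGen_iff_of_step h]
  constructor
  · rintro ⟨d, ⟨N, hN, rfl⟩, h1, rfl⟩
    have hle : N ≤ M := by
      by_contra hh
      exact absurd (hN M (by omega)) (by omega)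
    rw [(h0 N hle).1 h1]
  · rintro rfl
    exact ⟨_, ⟨M, fun i hi => hi, rfl⟩, (h0 M le_rfl).2 rfl, rfl⟩

def Prog.clear (r : ℕ) : Prog := .seq (.star (.act (.dec r))) (.act (.test r))

theorem Prog.rel_clear (r : ℕ) (c c' : ℕ → ℕ) :
    (Prog.clear r).rel c c' ↔ c' = update c r 0 := by
  have := Prog.rel_loop (p := .act (.dec r)) (r := r) (s := fun i => update c r (c r - i)) (c r)
    (fun i c' => by
      simp only [Prog.rel, Act.rel, update_self, update_idem, Nat.sub_sub, Nat.sub_pos_iff_lt])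
    (fun i hi => by simp only [update_self]; omega) c'
  simpa [Prog.clear] using this

/-- Adds counter `x` to counter `y` and clears `x`. -/
def Prog.move (x y : ℕ) : Prog :=
  .seq (.star (.seq (.act (.dec x)) (.act (.inc y)))) (.act (.test x))

theorem Prog.rel_move {x y : ℕ} (hxy : x ≠ y) (c c' : ℕ → ℕ) :
    (Prog.move x y).rel c c' ↔ c' = update (update c x 0) y (c y + c x) := by
  have := Prog.rel_loop (p := .seq (.act (.dec x)) (.act (.inc y))) (r := x)
    (s := fun i => update (update c x (c x - i)) y (c y + i)) (c x)
    (fun i c' => by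
      simp only [Prog.rel, Act.rel, update_of_ne hxy, update_self]
      constructor
      · rintro ⟨d, ⟨h1, rfl⟩, rfl⟩
        refine ⟨by omega, ?_⟩
        ext r
        simp only [update_apply]
        grind
      · rintro ⟨h1, rfl⟩
        refine ⟨_, ⟨by omega, rfl⟩, ?_⟩
        ext r
        simp only [update_apply]
        grind)
    (fun i hi => by simp only [update_of_ne hxy, update_self]; omega) c'
  simpa [Prog.move] using this

/-- Adds counter `x` to counter `y`, using the auxiliary counter `s`. -/
def Prog.copy (x y s : ℕ) : Prog :=
  .seq (.seq (.star (.seq (.act (.dec x)) (.seq (.act (.inc y)) (.act (.inc s)))))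
    (.act (.test x))) (.move s x)

theorem Prog.rel_copy {x y s : ℕ} (hxy : x ≠ y) (hxs : x ≠ s) (hys : y ≠ s) (c c' : ℕ → ℕ)
    (hs : c s = 0) : (Prog.copy x y s).rel c c' ↔ c' = update c y (c y + c x) := by
  have := Prog.rel_loop (p := .seq (.act (.dec x)) (.seq (.act (.inc y)) (.act (.inc s)))) (r := x)
    (s := fun i => update (update (update c x (c x - i)) y (c y + i)) s i) (c x)
    (fun i c' => by
      simp only [Prog.rel, Act.rel, update_of_ne hxy, update_self, update_of_ne hxs]
      constructor
      · rintro ⟨d, ⟨h1, rfl⟩, d, rfl, rfl⟩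
        refine ⟨by omega, ?_⟩
        ext r
        simp only [update_apply]
        grind
      · rintro ⟨h1, rfl⟩
        refine ⟨_, ⟨by omega, rfl⟩, _, rfl, ?_⟩
        ext r
        simp only [update_apply]
        grind)
    (fun i hi => by simp only [update_of_ne hxy, update_of_ne hxs, update_self]; omega)
  rw [show update (update (update c x (c x - 0)) y (c y + 0)) s 0 = c by
    ext r; simp only [update_apply]; grind] at this
  rw [Prog.copy, Prog.rel]
  simp only [this, Prog.rel_move hxs.symm, exists_eq_left]
  apply Eq.congr_right
  ext r
  simp only [update_apply]
  grind

/-- Clears the counters `K, …, K + m - 1`. -/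
def Prog.clearRange (K : ℕ) : ℕ → Prog
  | 0 => .act .nop
  | m + 1 => .seq (.clearRange K m) (.clear (K + m))

theorem Prog.rel_clearRange (K m : ℕ) (c c' : ℕ → ℕ) :
    (Prog.clearRange K m).rel c c' ↔ c' = fun r => if K ≤ r ∧ r < K + m then 0 else c r := by
  induction m generalizing c' with
  | zero =>
    simp only [clearRange, Prog.rel, Act.rel]
    apply Eq.congr_right
    ext r
    grind
  | succ m ih =>
    simp only [clearRange, Prog.rel, ih, exists_eq_left, rel_clear]
    apply Eq.congr_right
    ext r
    simp only [update_apply]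
    grind

/-! ### Partial recursive functions are computed by counter programs -/

/-- For all choices of registers for the arguments and the result, and all bounds `K` from which on
the registers are free, some program computes `f`. -/
def Computes {n : ℕ} (f : List.Vector ℕ n →. ℕ) : Prop :=
  ∀ (xs : List.Vector ℕ n) (out K : ℕ), (∀ x ∈ xs.toList, x < K) → out < K → out ∉ xs.toList →
    ∃ p : Prog, ∀ c : ℕ → ℕ, (∀ r, K ≤ r → c r = 0) → c out = 0 →
      ∀ c', p.rel c c' ↔ ∃ y ∈ f (xs.map c), c' = update c out y

theorem vector_map_congr {n : ℕ} {α β : Type*} (xs : List.Vector α n) {c d : α → β}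
    (h : ∀ x ∈ xs.toList, c x = d x) : xs.map c = xs.map d := by
  apply List.Vector.eq
  simpa using h

theorem vector_map_update {n : ℕ} (xs : List.Vector ℕ n) {c : ℕ → ℕ} {r a : ℕ}
    (h : r ∉ xs.toList) : xs.map (update c r a) = xs.map c :=
  vector_map_congr xs fun x hx => by
    rw [update_of_ne]
    rintro rfl
    exact h hx

theorem computes_zero : Computes (n := 0) (PFun.lift fun _ => 0) := by
  intro xs out K _ _ _
  refine ⟨.act .nop, fun c _ hout c' => ?_⟩
  simp [Prog.rel, Act.rel, ← hout]

theorem computes_get {n : ℕ} (i : Fin n) :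
    Computes (n := n) (PFun.lift fun v => v.get i) := by
  intro xs out K hxs hout hno
  have hi : xs.get i ∈ xs.toList := List.Vector.get_mem i xs
  have hlt := hxs _ hi
  refine ⟨.copy (xs.get i) out K, fun c hc h0 c' => ?_⟩
  rw [Prog.rel_copy (fun h => hno (by rwa [← h])) (by omega) (by omega) _ _ (hc K le_rfl), h0]
  simp

theorem computes_succ : Computes (n := 1) (PFun.lift fun v => v.head.succ) := by
  intro xs out K hxs hout hno
  obtain ⟨p, hp⟩ := computes_get (0 : Fin 1) xs out K hxs hout hno
  refine ⟨.seq p (.act (.inc out)), fun c hc h0 c' => ?_⟩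
  simp [Prog.rel, Act.rel, hp c hc h0]

theorem vector_map_cons {n : ℕ} {α β : Type*} (f : α → β) (a : α) (v : List.Vector α n) :
    (a ::ᵥ v).map f = f a ::ᵥ v.map f := rfl

/-- The store that has the entries of `v` from position `K` on. -/
def writeFrom {m : ℕ} (c : ℕ → ℕ) (K : ℕ) (v : List.Vector ℕ m) : ℕ → ℕ :=
  fun r => if r < K then c r else v.toList.getD (r - K) 0

theorem writeFrom_nil {c : ℕ → ℕ} {K : ℕ} (hc : ∀ r, K ≤ r → c r = 0) :
    writeFrom c K (List.Vector.nil : List.Vector ℕ 0) = c := by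
  ext r
  simp only [writeFrom]
  split_ifs with h
  · rfl
  · simp [hc r (by omega)]

theorem writeFrom_cons {m : ℕ} (c : ℕ → ℕ) (K a : ℕ) (v : List.Vector ℕ m) :
    writeFrom c K (a ::ᵥ v) = writeFrom (update c K a) (K + 1) v := by
  ext r
  simp only [writeFrom, List.Vector.toList_cons]
  rcases lt_trichotomy r K with h | rfl | h
  · simp [h, h.ne, Nat.lt_succ_of_lt h]
  · simp
  · obtain ⟨k, rfl⟩ := Nat.exists_eq_add_of_lt h
    simp [show ¬ K + k + 1 < K by omega, show K + k + 1 - K = k + 1 by omega,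
      show K + k + 1 - (K + 1) = k by omega]

/-- The functions are evaluated one after another, each into the first free register, after which
the bound of the free registers rises by one. The arguments lie below `K` and stay intact for the
later evaluations. -/
theorem computes_vector {n m : ℕ} (g : Fin m → List.Vector ℕ n →. ℕ) (hg : ∀ i, Computes (g i))
    (xs : List.Vector ℕ n) (K : ℕ) (hxs : ∀ x ∈ xs.toList, x < K) :
    ∃ p : Prog, ∀ c : ℕ → ℕ, (∀ r, K ≤ r → c r = 0) →
      ∀ c', p.rel c c' ↔ ∃ v ∈ List.Vector.mOfFn fun i => g i (xs.map c), c' = writeFrom c K v := by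
  induction m generalizing K with
  | zero =>
    refine ⟨.act .nop, fun c hc c' => ?_⟩
    simp [Prog.rel, Act.rel, List.Vector.mOfFn, writeFrom_nil hc]
  | succ m ih =>
    have hK : K ∉ xs.toList := fun h => (hxs K h).false
    obtain ⟨p, hp⟩ := hg 0 xs K (K + 1) (fun x hx => (hxs x hx).trans (Nat.lt_succ_self _))
      (Nat.lt_succ_self _) hK
    obtain ⟨q, hq⟩ := ih (fun i => g i.succ) (fun i => hg _) (K + 1)
      (fun x hx => (hxs x hx).trans (Nat.lt_succ_self _))
    refine ⟨.seq p q, fun c hc c' => ?_⟩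
    have hzero : ∀ a r, K + 1 ≤ r → update c K a r = 0 := fun a r hr => by
      rw [update_of_ne (by omega), hc r (by omega)]
    simp only [Prog.rel, hp c (fun r hr => hc r (by omega)) (hc K le_rfl)]
    simp only [List.Vector.mOfFn, Part.bind_eq_bind, Part.mem_bind_iff, Part.pure_eq_some,
      Part.mem_some_iff]
    constructor
    · rintro ⟨d, ⟨y, hy, rfl⟩, h⟩
      obtain ⟨v, hv, rfl⟩ := (hq _ (hzero y) _).1 h
      rw [vector_map_update xs hK] at hv
      exact ⟨_, ⟨y, hy, v, hv, rfl⟩, (writeFrom_cons ..).symm⟩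
    · rintro ⟨_, ⟨y, hy, v, hv, rfl⟩, rfl⟩
      refine ⟨_, ⟨y, hy, rfl⟩, (hq _ (hzero y) _).2 ⟨v, ?_, writeFrom_cons ..⟩⟩
      rwa [vector_map_update xs hK]

theorem map_writeFrom {m : ℕ} (c : ℕ → ℕ) (K : ℕ) (v : List.Vector ℕ m) :
    (List.Vector.ofFn fun i : Fin m => K + i).map (writeFrom c K v) = v := by
  ext i
  simp [writeFrom, List.Vector.get_eq_get_toList]

/-- The intermediate values occupy `K, …, K + n - 1` and serve as arguments of `f`; clearing them
afterwards leaves `out` as the only changed register. -/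
theorem Computes.comp {m n : ℕ} {f : List.Vector ℕ n →. ℕ} (g : Fin n → List.Vector ℕ m →. ℕ)
    (hf : Computes f) (hg : ∀ i, Computes (g i)) :
    Computes fun v => (List.Vector.mOfFn fun i => g i v) >>= f := by
  intro xs out K hxs hout hno
  obtain ⟨p, hp⟩ := computes_vector g hg xs K hxs
  obtain ⟨q, hq⟩ := hf (List.Vector.ofFn fun i : Fin n => K + i) out (K + n)
    (fun x hx => by
      simp only [List.Vector.toList_ofFn, List.mem_ofFn] at hx
      obtain ⟨i, rfl⟩ := hx
      omega) (by omega)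
    (fun hx => by
      simp only [List.Vector.toList_ofFn, List.mem_ofFn] at hx
      obtain ⟨i, hi⟩ := hx
      omega)
  refine ⟨.seq p (.seq q (.clearRange K n)), fun c hc h0 c' => ?_⟩
  have hz : ∀ (v : List.Vector ℕ n) r, K + n ≤ r → writeFrom c K v r = 0 := fun v r hr => by
    rw [writeFrom, if_neg (by omega), List.getD_eq_default]
    simp only [List.Vector.toList_length]
    omega
  have ho : ∀ v : List.Vector ℕ n, writeFrom c K v out = 0 := fun v => by
    rw [writeFrom, if_pos hout, h0]
  have key : ∀ (v : List.Vector ℕ n) y, (fun r => if K ≤ r ∧ r < K + n then 0 else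
      update (writeFrom c K v) out y r) = update c out y := fun v y => by
    ext r
    have h1 := hz v r
    have h2 := hc r
    simp only [update_apply]
    by_cases hr : r < K
    · rw [if_neg (by omega), writeFrom, if_pos hr]
    · rw [if_neg (show r ≠ out by omega), if_neg (show r ≠ out by omega), h2 (by omega)]
      split_ifs
      · rfl
      · exact h1 (by omega)
  have hb : ∀ y, y ∈ ((List.Vector.mOfFn fun i => g i (xs.map c)) >>= f) ↔
      ∃ v ∈ List.Vector.mOfFn fun i => g i (xs.map c), y ∈ f v := fun y => Part.mem_bind_iff
  simp only [Prog.rel, hp c hc, Prog.rel_clearRange, hb]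
  constructor
  · rintro ⟨_, ⟨v, hv, rfl⟩, d, hd, rfl⟩
    obtain ⟨y, hy, rfl⟩ := (hq _ (hz v) (ho v) _).1 hd
    rw [map_writeFrom] at hy
    exact ⟨y, ⟨v, hv, hy⟩, key v y⟩
  · rintro ⟨y, ⟨v, hv, hy⟩, rfl⟩
    refine ⟨_, ⟨v, hv, rfl⟩, _, (hq _ (hz v) (ho v) _).2 ⟨y, ?_, rfl⟩, (key v y).symm⟩
    rwa [map_writeFrom]

theorem Computes.rel_of_total {n : ℕ} {f : List.Vector ℕ n → ℕ} (hf : Computes (PFun.lift f))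
    (xs : List.Vector ℕ n) (out K : ℕ) (hxs : ∀ x ∈ xs.toList, x < K) (hout : out < K)
    (hno : out ∉ xs.toList) :
    ∃ p : Prog, ∀ c : ℕ → ℕ, (∀ r, K ≤ r → c r = 0) → c out = 0 →
      ∀ c', p.rel c c' ↔ c' = update c out (f (xs.map c)) := by
  obtain ⟨p, hp⟩ := hf xs out K hxs hout hno
  refine ⟨p, fun c hc h0 c' => ?_⟩
  simp [hp c hc h0]

theorem Computes.prec {n : ℕ} {f : List.Vector ℕ n → ℕ} {g : List.Vector ℕ (n + 2) → ℕ}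
    (hf : Computes (PFun.lift f)) (hg : Computes (PFun.lift g)) :
    Computes (n := n + 1) (PFun.lift fun v =>
      v.head.rec (f v.tail) fun y IH => g (y ::ᵥ IH ::ᵥ v.tail)) := by
  intro xs out K hxs hout hno
  obtain ⟨x, xs, rfl⟩ := xs.exists_eq_cons
  simp only [List.Vector.toList_cons, List.mem_cons, not_or, forall_eq_or_imp] at hxs hno
  obtain ⟨hx, hxs⟩ := hxs
  obtain ⟨hox, hno⟩ := hno
  have hmem : ∀ r, K ≤ r → r ∉ xs.toList := fun r hr h => by have := hxs r h; omega
  obtain ⟨p, hp⟩ := hf.rel_of_total xs out K hxs hout hno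
  -- `K` is the index of the loop, `K + 1` the new value, `K + 2` the number of rounds left
  obtain ⟨q, hq⟩ := hg.rel_of_total (K ::ᵥ out ::ᵥ xs) (K + 1) (K + 3)
    (by
      simp only [List.Vector.toList_cons, List.mem_cons, forall_eq_or_imp]
      exact ⟨by omega, by omega, fun r hr => by have := hxs r hr; omega⟩) (by omega)
    (by
      simp only [List.Vector.toList_cons, List.mem_cons, not_or]
      exact ⟨by omega, by omega, hmem _ (by omega)⟩)
  refine ⟨.seq p (.seq (.copy x (K + 2) (K + 3)) (.seq (.seq (.star (.seq (.act (.dec (K + 2)))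
    (.seq q (.seq (.clear out) (.seq (.move (K + 1) out) (.act (.inc K)))))))
    (.act (.test (K + 2)))) (.clear K))), fun c hc h0 c' => ?_⟩
  obtain ⟨F, hF⟩ : ∃ F : ℕ → ℕ, F = fun i =>
    Nat.rec (f (xs.map c)) (fun y IH => g (y ::ᵥ IH ::ᵥ xs.map c)) i := ⟨_, rfl⟩
  have hF0 : F 0 = f (xs.map c) := by subst hF; rfl
  have hF1 : ∀ i, F (i + 1) = g (i ::ᵥ F i ::ᵥ xs.map c) := fun i => by subst hF; rfl
  -- Invariant after `i` rounds: `out` holds `F i`, the index `K` holds `i`, and `K + 2` holds the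
  -- `c x - i` rounds that remain, so that a zero test detects the end.
  have hloop := Prog.rel_loop (p := .seq (.act (.dec (K + 2)))
    (.seq q (.seq (.clear out) (.seq (.move (K + 1) out) (.act (.inc K)))))) (r := K + 2)
    (s := fun i => update (update (update c out (F i)) K i) (K + 2) (c x - i)) (c x)
    (fun i c' => by
      set s : ℕ → ℕ := update (update (update c out (F i)) K i) (K + 2) (c x - i) with hs
      set d := update s (K + 2) (s (K + 2) - 1) with hd
      have hd0 : ∀ r, K + 3 ≤ r → d r = 0 := fun r hr => by
        have := hc r (by omega)
        rw [hd, update_of_ne (by omega), hs, update_of_ne (by omega), update_of_ne (by omega),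
          update_of_ne (by omega), this]
      have hd1 : d (K + 1) = 0 := by
        rw [hd, update_of_ne (by omega), hs, update_of_ne (by omega), update_of_ne (by omega),
          update_of_ne (by omega), hc _ (by omega)]
      have hdv : (K ::ᵥ out ::ᵥ xs).map d = i ::ᵥ F i ::ᵥ xs.map c := by
        rw [vector_map_cons, vector_map_cons, hd, vector_map_update _ (hmem _ (by omega)), hs,
          vector_map_update _ (hmem _ (by omega)), vector_map_update _ (hmem _ (by omega)),
          vector_map_update _ hno]
        congr 1
        · rw [update_of_ne (by omega), update_of_ne (by omega), update_self]
        congr 1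
        rw [update_of_ne (by omega), update_of_ne (by omega), update_of_ne (by omega), update_self]
      have hs2 : s (K + 2) = c x - i := by rw [hs, update_self]
      have hq' := hq d hd0 hd1
      rw [hdv, ← hF1] at hq'
      simp only [Prog.rel, Act.rel, Prog.rel_clear, Prog.rel_move (show K + 1 ≠ out by omega),
        exists_eq_left, and_assoc]
      have hpos : 0 < s (K + 2) ↔ i < c x := by omega
      rw [hpos]
      have hend : ∀ e, q.rel d e → update (update (update (update e out 0) (K + 1) 0) out
          (update e out 0 out + update e out 0 (K + 1))) K
          (update (update (update e out 0) (K + 1) 0) out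
          (update e out 0 out + update e out 0 (K + 1)) K + 1) =
          update (update (update c out (F (i + 1))) K (i + 1)) (K + 2) (c x - (i + 1)) := by
        intro e he
        rw [hq'] at he
        subst he
        ext r
        have hc1 := hc r
        simp only [update_apply, hd, hs]
        grind
      constructor
      · rintro ⟨_, h1, rfl, e, he, rfl⟩
        exact ⟨h1, hend e he⟩
      · rintro ⟨h1, rfl⟩
        exact ⟨d, h1, rfl, _, (hq' _).2 rfl, (hend _ ((hq' _).2 rfl)).symm⟩)
    (fun i hi => by simp only [update_self]; omega)
  have hc3 : update c out (f (xs.map c)) (K + 3) = 0 := by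
    rw [update_of_ne (by omega), hc _ (by omega)]
  have h1 := hp c hc h0
  have h2 := Prog.rel_copy (x := x) (y := K + 2) (s := K + 3) (by omega) (by omega) (by omega)
    (update c out (f (xs.map c))) (hs := hc3)
  have h3 : update (update c out (f (xs.map c))) (K + 2)
      (update c out (f (xs.map c)) (K + 2) + update c out (f (xs.map c)) x) =
      update (update (update c out (F 0)) K 0) (K + 2) (c x - 0) := by
    ext r
    have hc1 := hc r
    simp only [update_apply, hF0]
    grind
  rw [h3] at h2
  rw [Prog.rel, exists_congr fun d => and_congr_left' (h1 d), exists_eq_left, Prog.rel,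
    exists_congr fun d => and_congr_left' (h2 d), exists_eq_left, Prog.rel,
    exists_congr fun d => and_congr_left' (hloop d), exists_eq_left, Prog.rel_clear]
  trans c' = update c out (F (c x))
  · apply Eq.congr_right
    ext r
    have hc1 := hc r
    simp only [update_apply]
    grind
  · simp [hF]

/-- The register `out` is itself the search variable. Inside the star, `dec K` blocks on the value
zero, and `test K` after it blocks on any other value, so a run can end only at the least zero of
`f`, and no run ends if there is none. -/
theorem Computes.rfind {n : ℕ} {f : List.Vector ℕ (n + 1) → ℕ} (hf : Computes (PFun.lift f)) :
    Computes fun v => Nat.rfind fun k => Part.some (decide (f (k ::ᵥ v) = 0)) := by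
  intro xs out K hxs hout hno
  obtain ⟨p, hp⟩ := hf.rel_of_total (out ::ᵥ xs) K (K + 1)
    (by
      simp only [List.Vector.toList_cons, List.mem_cons, forall_eq_or_imp]
      exact ⟨by omega, fun r hr => by have := hxs r hr; omega⟩) (by omega)
    (by
      simp only [List.Vector.toList_cons, List.mem_cons, not_or]
      exact ⟨by omega, fun h => by have := hxs _ h; omega⟩)
  refine ⟨.seq (.star (.seq p (.seq (.act (.dec K)) (.seq (.clear K) (.act (.inc out))))))
    (.seq p (.act (.test K))), fun c hc h0 c' => ?_⟩
  have hp' : ∀ i d, p.rel (update c out i) d ↔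
      d = update (update c out i) K (f (i ::ᵥ xs.map c)) := fun i d => by
    rw [hp _ (fun r hr => by rw [update_of_ne (by omega), hc r (by omega)])
      (by rw [update_of_ne (by omega), hc K le_rfl]), vector_map_cons, update_self,
      vector_map_update _ hno]
  have hstar := reflTransGen_iff_of_step
    (B := (Prog.seq p (.seq (.act (.dec K)) (.seq (.clear K) (.act (.inc out))))).rel)
    (s := fun i => update c out i) (P := fun i => f (i ::ᵥ xs.map c) ≠ 0)
    (fun i c' => by
      simp only [Prog.rel, hp', Act.rel, Prog.rel_clear, exists_eq_left, and_assoc, update_self]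
      rw [Nat.pos_iff_ne_zero, exists_and_left, exists_eq_left]
      apply and_congr_right'
      apply Eq.congr_right
      ext r
      have hc1 := hc r
      simp only [update_apply]
      grind)
  simp only [show update c out 0 = c by rw [← h0, update_eq_self]] at hstar
  have hmem : ∀ N, N ∈ (Nat.rfind fun k => Part.some (decide (f (k ::ᵥ xs.map c) = 0))) ↔
      f (N ::ᵥ xs.map c) = 0 ∧ ∀ i < N, f (i ::ᵥ xs.map c) ≠ 0 := fun N => by
    refine Nat.mem_rfind.trans (and_congr ?_ (forall₂_congr fun i _ => ?_))
    · exact Part.mem_some_iff.trans (by simp [eq_comm])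
    · exact Part.mem_some_iff.trans (by simp [eq_comm])
  simp only [Prog.rel, Act.rel, hmem]
  constructor
  · rintro ⟨d, hd, e, he, h1, rfl⟩
    obtain ⟨N, hN, rfl⟩ := (hstar _).1 hd
    rw [hp'] at he
    subst he
    rw [update_self] at h1
    refine ⟨N, ⟨h1, hN⟩, ?_⟩
    ext r
    have hc1 := hc r
    simp only [update_apply]
    grind
  · rintro ⟨N, ⟨h1, h2⟩, rfl⟩
    refine ⟨_, (hstar _).2 ⟨N, h2, rfl⟩, _, (hp' _ _).2 rfl,
      by rw [update_self, h1], ?_⟩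
    rw [h1]
    ext r
    have hc1 := hc r
    simp only [update_apply]
    grind

theorem computes_of_primrec' {n : ℕ} {f : List.Vector ℕ n → ℕ} (hf : Nat.Primrec' f) :
    Computes (PFun.lift f) := by
  induction hf with
  | zero => exact computes_zero
  | succ => exact computes_succ
  | get i => exact computes_get i
  | comp g _ _ hf hg =>
    have := Computes.comp _ hf hg
    rename_i f' _ _
    refine (congrArg Computes (funext fun v => ?_)).mp this
    have := List.Vector.mOfFn_pure (m := Part) fun i => g i v
    exact (congrArg (Part.bind · (PFun.lift f')) this).trans (Part.bind_some _ _)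
  | prec _ _ hf hg => exact hf.prec hg

theorem computes_of_partrec' {n : ℕ} {f : List.Vector ℕ n →. ℕ} (hf : Nat.Partrec' f) :
    Computes f := by
  induction hf with
  | prim h => exact computes_of_primrec' h
  | comp g _ _ hf hg => exact hf.comp g hg
  | rfind _ hf => exact hf.rfind

/-- The domain of a partial recursive function is the halting set of a counter program. -/
theorem exists_prog_of_partrec {f : ℕ →. ℕ} (hf : Partrec f) :
    ∃ p : Prog, ∀ n, (f n).Dom ↔ ∃ c', p.rel (Pi.single 0 n) c' := by
  obtain ⟨p, hp⟩ := computes_of_partrec' (Nat.Partrec'.part_iff₁.2 hf) (0 ::ᵥ .nil) 1 2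
    (by simp) (by simp) (by simp)
  refine ⟨p, fun n => ?_⟩
  have hz : ∀ r ≠ 0, (Pi.single 0 n : ℕ → ℕ) r = 0 := fun r hr => Pi.single_eq_of_ne hr _
  simp only [hp (Pi.single 0 n) (fun r hr => hz r (by omega)) (hz 1 one_ne_zero),
    vector_map_cons, List.Vector.head_cons, Pi.single_eq_same, Part.dom_iff_mem]
  exact ⟨fun ⟨y, hy⟩ => ⟨_, y, hy, rfl⟩, fun ⟨_, y, hy, _⟩ => ⟨y, hy⟩⟩

/-! ### Compiling programs to transition lists -/

/-- A transition `(q, a, q')` goes from state `q` to state `q'` and performs the action `a`. -/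
abbrev Trans := ℕ × Act × ℕ

def transStep (T : List Trans) (x y : ℕ × (ℕ → ℕ)) : Prop :=
  ∃ a, (x.1, a, y.1) ∈ T ∧ Act.rel a x.2 y.2

def Prog.size : Prog → ℕ
  | .act _ => 1
  | .seq p q => p.size + q.size
  | .star p => p.size + 2

theorem Prog.size_pos (p : Prog) : 0 < p.size := by
  induction p <;> simp only [Prog.size] <;> omega

/-- The compiled program runs from state `a` to state `a + p.size`. -/
def Prog.compile : Prog → ℕ → List Trans
  | .act b, a => [(a, b, a + 1)]
  | .seq p q, a => p.compile a ++ q.compile (a + p.size)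
  | .star p, a => (a, .nop, a + 1) :: (a + 1 + p.size, .nop, a) :: (a, .nop, a + (p.size + 2)) ::
      p.compile (a + 1)

/-- No transition starts at the end state, which is what allows runs of composite programs to be cut
at the borders of their parts. The absence of loops `s = t` is needed for the token: a loop would
not change it and so could not require its presence. -/
theorem Prog.compile_bounds {p : Prog} {a s t : ℕ} {b : Act} (h : (s, b, t) ∈ p.compile a) :
    a ≤ s ∧ s < a + p.size ∧ a ≤ t ∧ t ≤ a + p.size ∧ s ≠ t := by
  induction p generalizing a with
  | act b =>
    simp only [compile, List.mem_singleton, Prod.mk.injEq] at h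
    simp only [size]
    omega
  | seq p q ihp ihq =>
    simp only [compile, List.mem_append] at h
    simp only [size]
    rcases h with h | h
    · have := ihp h
      omega
    · have := ihq h
      omega
  | star p ih =>
    simp only [compile, List.mem_cons, Prod.mk.injEq] at h
    have := p.size_pos
    simp only [size]
    rcases h with h | h | h | h
    iterate 3 omega
    have := ih h
    omega

open Relation

theorem transStep.mono {T T' : List Trans} (h : ∀ t ∈ T, t ∈ T') {x y : ℕ × (ℕ → ℕ)}
    (H : ReflTransGen (transStep T) x y) : ReflTransGen (transStep T') x y :=
  H.lift id fun _ _ ⟨a, ha, hr⟩ => ⟨a, h _ ha, hr⟩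

theorem Prog.run_of_rel {p : Prog} (a : ℕ) {c c' : ℕ → ℕ} (h : p.rel c c') :
    ReflTransGen (transStep (p.compile a)) (a, c) (a + p.size, c') := by
  induction p generalizing a c c' with
  | act b => exact .single ⟨b, by simp [compile, size], h⟩
  | seq p q ihp ihq =>
    obtain ⟨d, h1, h2⟩ := h
    have h2 := ihq (a + p.size) h2
    rw [add_assoc] at h2
    exact (transStep.mono (fun t ht => List.mem_append_left _ ht) (ihp a h1)).trans
      (transStep.mono (fun t ht => List.mem_append_right _ ht) h2)
  | star p ih =>
    have hback : ReflTransGen (transStep ((Prog.star p).compile a)) (a, c) (a, c') := by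
      induction h with
      | refl => exact .refl
      | tail _ hb ihr =>
        refine ihr.trans (ReflTransGen.head (b := (a + 1, _)) ⟨.nop, by simp [compile], rfl⟩ ?_)
        refine ReflTransGen.tail (b := (a + 1 + p.size, _)) (transStep.mono ?_ (ih (a + 1) hb))
          ⟨.nop, by simp [compile], rfl⟩
        intro t ht
        simp [compile, ht]
    exact hback.tail ⟨.nop, by simp [compile, size], rfl⟩

/-- In each case `key` treats runs from an arbitrary state to the end state, by induction from the
end backwards. Its clauses say, according to the region containing the current state, what the rest
of the run achieves; a border state may belong to two regions. -/
theorem Prog.rel_of_run {p : Prog} (a : ℕ) {c c' : ℕ → ℕ}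
    (h : ReflTransGen (transStep (p.compile a)) (a, c) (a + p.size, c')) : p.rel c c' := by
  induction p generalizing a c c' with
  | act b =>
    have key : ∀ x, ReflTransGen (transStep ((Prog.act b).compile a)) x (a + 1, c') →
        (x.1 = a + 1 → x.2 = c') ∧ (x.1 = a → b.rel x.2 c') := by
      intro x hx
      induction hx using ReflTransGen.head_induction_on with
      | refl => simp
      | head hs _ ih =>
        obtain ⟨b', hb, hr⟩ := hs
        simp only [compile, List.mem_singleton, Prod.mk.injEq] at hb
        obtain ⟨h1, rfl, h2⟩ := hb
        refine ⟨fun h => by omega, fun _ => ?_⟩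
        rwa [← ih.1 h2]
    exact (key _ h).2 rfl
  | seq p q ihp ihq =>
    have key : ∀ x, ReflTransGen (transStep ((Prog.seq p q).compile a)) x
          (a + (p.size + q.size), c') →
        (x.1 ≤ a + p.size → ∃ d, ReflTransGen (transStep (p.compile a)) x (a + p.size, d) ∧
          ReflTransGen (transStep (q.compile (a + p.size))) (a + p.size, d)
            (a + p.size + q.size, c')) ∧
        (a + p.size ≤ x.1 → ReflTransGen (transStep (q.compile (a + p.size))) x
          (a + p.size + q.size, c')) := by
      intro x hx
      induction hx using ReflTransGen.head_induction_on with
      | refl =>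
        have := q.size_pos
        rw [← add_assoc]
        exact ⟨fun h => by simp only at h; omega, fun _ => .refl⟩
      | @head x y hs _ ih =>
        obtain ⟨b, hb, hr⟩ := hs
        simp only [compile, List.mem_append] at hb
        rcases hb with hb | hb
        · have hbd := compile_bounds hb
          refine ⟨fun h => ?_, fun h => by omega⟩
          obtain ⟨d, h1, h2⟩ := ih.1 (by omega)
          exact ⟨d, h1.head ⟨b, hb, hr⟩, h2⟩
        · have hbd := compile_bounds hb
          have hq := (ih.2 (by omega)).head ⟨b, hb, hr⟩
          refine ⟨fun h => ⟨x.2, ?_, ?_⟩, fun _ => hq⟩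
          · rw [show x = (a + p.size, x.2) from Prod.ext (by simp only; omega) rfl]
          · rwa [show x = (a + p.size, x.2) from Prod.ext (by simp only; omega) rfl] at hq
    obtain ⟨d, h1, h2⟩ := (key _ h).1 (by simp only; omega)
    exact ⟨d, ihp a h1, ihq _ h2⟩
  | star p ih =>
    have key : ∀ x, ReflTransGen (transStep ((Prog.star p).compile a)) x
          (a + (p.size + 2), c') →
        (x.1 = a → ReflTransGen p.rel x.2 c') ∧
        (a + 1 ≤ x.1 → x.1 ≤ a + 1 + p.size → ∃ d,
          ReflTransGen (transStep (p.compile (a + 1))) x (a + 1 + p.size, d) ∧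
          ReflTransGen p.rel d c') ∧
        (a + (p.size + 2) ≤ x.1 → x.2 = c') := by
      intro x hx
      induction hx using ReflTransGen.head_induction_on with
      | refl => exact ⟨fun h => by simp at h, fun _ h => by simp only at h; omega, fun _ => rfl⟩
      | @head x y hs _ hi =>
        obtain ⟨i1, i2, i3⟩ := hi
        obtain ⟨b, hb, hr⟩ := hs
        simp only [compile, List.mem_cons, Prod.mk.injEq] at hb
        rcases hb with ⟨h1, rfl, h2⟩ | ⟨h1, rfl, h2⟩ | ⟨h1, rfl, h2⟩ | hb
        · refine ⟨fun _ => ?_, fun h => by omega, fun h => by omega⟩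
          obtain ⟨d, hd, hd'⟩ := i2 (by omega) (by omega)
          rw [show y = (a + 1, x.2) from Prod.ext h2 hr] at hd
          exact hd'.head (ih _ hd)
        · have hr : y.2 = x.2 := hr
          refine ⟨fun h => by omega, fun _ _ => ⟨x.2, ?_, hr ▸ i1 h2⟩, fun h => by omega⟩
          rw [show x = (a + 1 + p.size, x.2) from Prod.ext h1 rfl]
        · have hr : y.2 = x.2 := hr
          refine ⟨fun h => ?_, fun h => by omega, fun h => by omega⟩
          rw [← hr, i3 (by omega)]
        · have hbd := compile_bounds hb
          refine ⟨fun h => by omega, fun _ _ => ?_, fun h => by omega⟩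
          obtain ⟨d, hd, hd'⟩ := i2 (by omega) (by omega)
          exact ⟨d, hd.head ⟨b, hb, hr⟩, hd'⟩
    exact (key _ h).1 rfl

/-! ### Vector addition systems with zero tests -/

/-- A finite system of counters: the letter `a` adds `delta a i` to counter `i`, which has to be
nonnegative afterwards, and zero if `zero a i` holds. The input number is added to the initial values
of the counters in `input`; at the end, the counters in `final` have to be zero. -/
structure Net (ι Λ : Type) where
  delta : Λ → ι → ℤ
  zero : Λ → ι → Bool
  init : ι → ℕ
  input : ι → Bool
  final : ι → Bool

variable {ι κ Λ : Type}

/-- The word `w` is the label of a successful run from the marking `M`. -/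
def Net.Valid (N : Net ι Λ) : (ι → ℤ) → List Λ → Prop
  | M, [] => ∀ i, N.final i → M i = 0
  | M, a :: w => (∀ i, 0 ≤ M i + N.delta a i ∧ (N.zero a i → M i + N.delta a i = 0)) ∧
      N.Valid (fun i => M i + N.delta a i) w

def Net.start (N : Net ι Λ) (n : ℕ) (i : ι) : ℤ :=
  (N.init i + if N.input i then n else 0 : ℕ)

def Net.Accepts (N : Net ι Λ) (n : ℕ) : Prop := ∃ w ≠ [], N.Valid (N.start n) w

/-- Counters become coordinates of vectors, hence have to be numbered by some `Fin k`. -/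
def Net.reindex (N : Net ι Λ) (e : κ ≃ ι) : Net κ Λ where
  delta a i := N.delta a (e i)
  zero a i := N.zero a (e i)
  init i := N.init (e i)
  input i := N.input (e i)
  final i := N.final (e i)

theorem Net.valid_reindex (N : Net ι Λ) (e : κ ≃ ι) (M : ι → ℤ) (w : List Λ) :
    (N.reindex e).Valid (fun i => M (e i)) w ↔ N.Valid M w := by
  induction w generalizing M with
  | nil => exact e.forall_congr fun {i} => by simp [reindex]
  | cons a w ih =>
    refine and_congr (e.forall_congr fun {i} => by simp [reindex]) ?_
    exact ih fun i => M i + N.delta a i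

theorem Net.accepts_reindex (N : Net ι Λ) (e : κ ≃ ι) (n : ℕ) :
    (N.reindex e).Accepts n ↔ N.Accepts n := by
  refine exists_congr fun w => and_congr_right' ?_
  rw [← N.valid_reindex e]
  refine iff_of_eq (congrArg (Valid _ · w) (funext fun i => ?_))
  rfl

/-! ### Counter programs as vector addition systems with zero tests -/

def Act.reg : Act → ℕ
  | .inc r => r
  | .dec r => r
  | .test r => r
  | .nop => 0

def Act.delta : Act → ℕ → ℤ
  | .inc r, i => if i = r then 1 else 0
  | .dec r, i => if i = r then -1 else 0
  | .test _, _ => 0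
  | .nop, _ => 0

def Act.zero : Act → ℕ → Bool
  | .test r, i => i = r
  | _, _ => false

/-- The guard of `dec` is implied by the new value being a natural number, and a test may be read
off the new store because it changes nothing. Both guards thus become conditions on the marking
after the step. -/
theorem Act.rel_iff (b : Act) (c c' : ℕ → ℕ) :
    b.rel c c' ↔ (∀ r, (c' r : ℤ) = c r + b.delta r) ∧ ∀ r, b.zero r → c' r = 0 := by
  cases b with
  | inc r =>
    simp only [rel, delta, zero, funext_iff, Function.update_apply]
    constructor
    · intro h
      exact ⟨fun i => by rw [h]; split_ifs with hi <;> simp [hi], by simp⟩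
    · rintro ⟨h, -⟩ i
      have := h i
      split_ifs at * with hi <;> [subst hi; skip] <;> omega
  | dec r =>
    simp only [rel, delta, zero, funext_iff, Function.update_apply]
    constructor
    · rintro ⟨h0, h⟩
      refine ⟨fun i => ?_, by simp⟩
      rw [h]
      split_ifs with hi <;> [subst hi; skip] <;> omega
    · rintro ⟨h, -⟩
      refine ⟨?_, fun i => ?_⟩
      · have := h r
        simp only [if_true] at this
        omega
      · have := h i
        split_ifs at * with hi <;> [subst hi; skip] <;> omega
  | test r =>
    simp only [rel, delta, zero, funext_iff, add_zero, Nat.cast_inj, decide_eq_true_eq, forall_eq]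
    exact ⟨fun ⟨h, h'⟩ => ⟨h', by rw [h', h]⟩, fun ⟨h, h'⟩ => ⟨by rw [← h, h'], h⟩⟩
  | nop => simp [rel, delta, zero, funext_iff]

theorem Act.delta_eq_zero {b : Act} {r : ℕ} (h : b.reg < r) : b.delta r = 0 := by
  cases b <;> simp only [reg, delta] at * <;> rw [if_neg (by omega)]

theorem Act.zero_eq_false {b : Act} {r : ℕ} (h : b.reg < r) : b.zero r = false := by
  cases b <;> simp only [reg, zero, decide_eq_false_iff_not] at *
  omega

/-- The registers and the states of a list of transitions become counters; a token marks the
current state. -/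
def transNet (T : List Trans) (R e : ℕ) : Net (Fin (R + 1) ⊕ Fin (e + 1)) (Fin T.length) where
  delta a
    | .inl r => T[a].2.1.delta r
    | .inr q => (if (q : ℕ) = T[a].2.2 then 1 else 0) - if (q : ℕ) = T[a].1 then 1 else 0
  zero a
    | .inl r => T[a].2.1.zero r
    | .inr _ => false
  init
    | .inl _ => 0
    | .inr q => if (q : ℕ) = 0 then 1 else 0
  input
    | .inl r => (r : ℕ) = 0
    | .inr _ => false
  final
    | .inl _ => false
    | .inr q => (q : ℕ) ≠ e

def marking (R e : ℕ) (x : ℕ × (ℕ → ℕ)) : Fin (R + 1) ⊕ Fin (e + 1) → ℤ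
  | .inl r => x.2 r
  | .inr q => if (q : ℕ) = x.1 then 1 else 0

/-- The source state loses one token, so nonnegativity forces the token to be there; the other
conditions are those of the action. -/
theorem transNet_step {T : List Trans} {R e : ℕ} (hR : ∀ t ∈ T, t.2.1.reg ≤ R)
    (he : ∀ t ∈ T, t.1 ≤ e ∧ t.2.2 ≤ e ∧ t.1 ≠ t.2.2) (a : Fin T.length) (x : ℕ × (ℕ → ℕ)) :
    (∀ i, 0 ≤ marking R e x i + (transNet T R e).delta a i ∧
      ((transNet T R e).zero a i → marking R e x i + (transNet T R e).delta a i = 0)) ↔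
    x.1 = T[a].1 ∧ ∃ c', T[a].2.1.rel x.2 c' ∧
      (fun i => marking R e x i + (transNet T R e).delta a i) = marking R e (T[a].2.2, c') := by
  have hmem : T[a] ∈ T := List.getElem_mem _
  obtain ⟨h1, h2, h3⟩ := he _ hmem
  have hreg := hR _ hmem
  constructor
  · intro h
    have hs := (h (.inr ⟨T[a].1, by omega⟩)).1
    simp only [marking, transNet, if_neg h3, if_true] at hs
    have hx : x.1 = T[a].1 := by
      by_contra hne
      rw [if_neg (Ne.symm hne)] at hs
      simp at hs
    -- Registers above `R` have no counter, but no transition touches them.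
    have hnn : ∀ r, 0 ≤ (x.2 r : ℤ) + T[a].2.1.delta r := fun r => by
      by_cases hr : r < R + 1
      · exact (h (.inl ⟨r, hr⟩)).1
      · rw [Act.delta_eq_zero (by omega)]
        omega
    refine ⟨hx, fun r => ((x.2 r : ℤ) + T[a].2.1.delta r).toNat, ?_, ?_⟩
    · rw [Act.rel_iff]
      refine ⟨fun r => Int.toNat_of_nonneg (hnn r), fun r hz => ?_⟩
      by_cases hr : r < R + 1
      · have : (x.2 r : ℤ) + T[a].2.1.delta r = 0 := (h (.inl ⟨r, hr⟩)).2 hz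
        simp only [this, Int.toNat_zero]
      · rw [Act.zero_eq_false (by omega)] at hz
        cases hz
    · ext i
      rcases i with r | q
      · exact (Int.toNat_of_nonneg (hnn r)).symm
      · simp only [marking, transNet, hx]
        ring
  · rintro ⟨hx, c', hc, hm⟩ i
    rw [show marking R e x i + (transNet T R e).delta a i = marking R e (T[a].2.2, c') i from
      congrFun hm i]
    rcases i with r | q
    · refine ⟨by simp [marking], fun hz => ?_⟩
      simpa [marking] using ((Act.rel_iff ..).1 hc).2 r hz
    · refine ⟨by simp only [marking]; split_ifs <;> simp, fun hz => ?_⟩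
      cases hz

theorem marking_add_delta {T : List Trans} {R e : ℕ} (a : Fin T.length) {x : ℕ × (ℕ → ℕ)}
    {c' : ℕ → ℕ} (hx : x.1 = T[a].1) (hc : T[a].2.1.rel x.2 c') :
    (fun i => marking R e x i + (transNet T R e).delta a i) = marking R e (T[a].2.2, c') := by
  ext i
  rcases i with r | q
  · exact (((Act.rel_iff ..).1 hc).1 r).symm
  · simp only [marking, transNet, hx]
    ring

theorem transNet_valid_iff {T : List Trans} {R e : ℕ} (hR : ∀ t ∈ T, t.2.1.reg ≤ R)
    (he : ∀ t ∈ T, t.1 ≤ e ∧ t.2.2 ≤ e ∧ t.1 ≠ t.2.2) (x : ℕ × (ℕ → ℕ)) (hx : x.1 ≤ e) :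
    (∃ w, (transNet T R e).Valid (marking R e x) w) ↔
      ∃ c', ReflTransGen (transStep T) x (e, c') := by
  constructor
  · rintro ⟨w, hw⟩
    induction w generalizing x with
    | nil =>
      -- The counter of the current state is `1`, so it cannot be among the final counters, which
      -- are those of all states but `e`.
      have h := hw (.inr ⟨x.1, by omega⟩)
      simp only [transNet, marking, if_true, one_ne_zero, imp_false, decide_eq_true_eq,
        not_not] at h
      exact ⟨x.2, by rw [← h]⟩
    | cons a w ih =>
      obtain ⟨h1, h2⟩ := hw
      obtain ⟨hs, c, hc, hm⟩ := (transNet_step hR he a x).1 h1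
      have hmem : T[a] ∈ T := List.getElem_mem _
      rw [hm] at h2
      obtain ⟨c', hc'⟩ := ih _ (he _ hmem).2.1 h2
      exact ⟨c', hc'.head ⟨T[a].2.1, by rw [hs]; exact hmem, hc⟩⟩
  · rintro ⟨c', h⟩
    induction h using ReflTransGen.head_induction_on with
    | refl =>
      refine ⟨[], fun i hi => ?_⟩
      rcases i with r | q
      · cases hi
      · simpa [transNet, marking] using hi
    | @head x y hs _ ih =>
      obtain ⟨b, hb, hr⟩ := hs
      obtain ⟨w, hw⟩ := ih (he _ hb).2.1
      obtain ⟨k, hk, hb'⟩ := List.getElem_of_mem hb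
      have hm := marking_add_delta (R := R) (e := e) (T := T) ⟨k, hk⟩ (x := x) (c' := y.2)
        (by simp [hb']) (by simpa [hb'] using hr)
      have hy : ((T[(⟨k, hk⟩ : Fin T.length)]).2.2, y.2) = y := by simp [hb']
      refine ⟨⟨k, hk⟩ :: w, (transNet_step hR he ⟨k, hk⟩ x).2 ⟨by simp [hb'], y.2,
        by simpa [hb'] using hr, hm⟩, ?_⟩
      rwa [hm, hy]

theorem exists_net_of_prog (p : Prog) : ∃ (k m : ℕ) (N : Net (Fin k) (Fin m)), 0 < m ∧
    ∀ n, (∃ c', p.rel (Pi.single 0 n) c') ↔ N.Accepts n := by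
  set T := p.compile 0 with hT
  obtain ⟨R, hR⟩ : ∃ R, ∀ t ∈ T, t.2.1.reg ≤ R :=
    ⟨(T.map fun t => t.2.1.reg).sum, fun t ht =>
      List.le_sum_of_mem (List.mem_map_of_mem (f := fun t : Trans => t.2.1.reg) ht)⟩
  have he : ∀ t ∈ T, t.1 ≤ p.size ∧ t.2.2 ≤ p.size ∧ t.1 ≠ t.2.2 := by
    rintro ⟨s, b, t⟩ ht
    have := Prog.compile_bounds ht
    simp only
    omega
  have hpos : 0 < T.length := by
    rw [hT]
    have : ∀ (p : Prog) a, 0 < (p.compile a).length := by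
      intro p
      induction p with
      | act => simp [Prog.compile]
      | seq p q ih => intro a; simp only [Prog.compile, List.length_append]; have := ih a; omega
      | star => simp [Prog.compile]
    exact this p 0
  refine ⟨_, T.length, (transNet T R p.size).reindex finSumFinEquiv.symm, hpos, fun n => ?_⟩
  rw [Net.accepts_reindex]
  have hstart : (transNet T R p.size).start n = marking R p.size (0, Pi.single 0 n) := by
    ext i
    rcases i with r | q
    · simp [Net.start, transNet, marking, Pi.single_apply]
    · simp [Net.start, transNet, marking]
  have hiff := transNet_valid_iff hR he (0, Pi.single 0 n) (Nat.zero_le _)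
  constructor
  · rintro ⟨c', hc⟩
    have hrun := Prog.run_of_rel 0 hc
    rw [zero_add] at hrun
    obtain ⟨w, hw⟩ := hiff.2 ⟨c', hrun⟩
    rw [← hstart] at hw
    refine ⟨w, ?_, hw⟩
    -- The empty word would leave the token at state `0`, which differs from the end state.
    rintro rfl
    have h0 := hw (.inr 0)
    have := p.size_pos
    simp [Net.start, transNet, this.ne] at h0
  · rintro ⟨w, -, hw⟩
    rw [hstart] at hw
    obtain ⟨c', hc⟩ := hiff.1 ⟨w, hw⟩
    refine ⟨c', Prog.rel_of_run 0 ?_⟩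
    rwa [zero_add]

/-! ### Evaluating networks with integer parameters -/

theorem dot_nil (v : Vec) : dot [] v = 0 := by simp [dot]

theorem dot_cons (a b : ℝ) (u v : Vec) : dot (a :: u) (b :: v) = a * b + dot u v := by simp [dot]

theorem dot_append {u v : Vec} (u' v' : Vec) (h : u.length = v.length) :
    dot (u ++ u') (v ++ v') = dot u v + dot u' v' := by
  rw [dot, List.zipWith_append h, List.sum_append, dot, dot]

theorem dot_ofFn {n : ℕ} (f g : Fin n → ℝ) :
    dot (List.ofFn f) (List.ofFn g) = ∑ i, f i * g i := by
  induction n with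
  | zero => simp [dot]
  | succ n ih => rw [List.ofFn_succ, List.ofFn_succ, dot_cons, ih, Fin.sum_univ_succ]

/-- A neuron with integer parameters. -/
def intNeuron (b : ℤ) (l : List ℤ) : NeuronCode := ((b, 0), l.map fun z => (z, 0))

/-- A row of a matrix with integer entries. -/
def intRow (l : List ℤ) : List RatCode := l.map fun z => (z, 0)

theorem vecVal_intRow (l : List ℤ) : vecVal (intRow l) = l.map fun z : ℤ => (z : ℝ) := by
  simp [vecVal, intRow, RatCode.val, Function.comp_def]

theorem intNeuron_eval (b : ℤ) (l : List ℤ) (x : Vec) :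
    RatCode.val (intNeuron b l).1 + dot (vecVal (intNeuron b l).2) x =
      b + dot (l.map fun z : ℤ => (z : ℝ)) x := by
  simp [vecVal, intNeuron, RatCode.val, Function.comp_def]

theorem length_intNeuron (b : ℤ) (l : List ℤ) : (intNeuron b l).2.length = l.length := by
  simp [intNeuron]

theorem length_intRow (l : List ℤ) : (intRow l).length = l.length := by
  simp [intRow]

/-! ### Hardmax attention -/

theorem count_ofFn {α : Type*} [DecidableEq α] {n : ℕ} (f : Fin n → α) (a : α) :
    (List.ofFn f).count a = (Finset.univ.filter fun i => f i = a).card := by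
  induction n with
  | zero => simp
  | succ n ih =>
    rw [List.ofFn_succ, List.count_cons, ih, Fin.card_filter_univ_succ]
    by_cases h : f 0 = a <;> simp [h]

/-- If the scores are zero on `S` and negative elsewhere, then hardmax attention computes the mean
over `S`. -/
theorem sum_hardmax_mul {n : ℕ} {S : Finset (Fin n)} (hS : S.Nonempty) {s : Fin n → ℝ}
    (h0 : ∀ i ∈ S, s i = 0) (hneg : ∀ i ∉ S, s i < 0) (v : Fin n → ℝ) :
    ∑ i : Fin n, hardmax i (List.ofFn s) * v i = (∑ i ∈ S, v i) / S.card := by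
  obtain ⟨i₀, hi₀⟩ := hS
  have hget : ∀ i : Fin n, (List.ofFn s).getD i 0 = s i := fun i => by simp
  have hval : ∀ i : Fin n, hardmax i (List.ofFn s) = if i ∈ S then 1 / (S.card : ℝ) else 0 := by
    intro i
    simp only [hardmax, hget]
    by_cases hi : i ∈ S
    · rw [if_pos hi, if_pos, h0 i hi, count_ofFn]
      · congr 3
        ext j
        simp only [Finset.mem_filter, Finset.mem_univ, true_and]
        exact ⟨fun hj => by by_contra hn; exact (hneg j hn).ne hj, h0 j⟩
      · intro y hy
        obtain ⟨j, rfl⟩ := (List.mem_ofFn' _ _).1 hy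
        rw [h0 i hi]
        by_cases hj : j ∈ S
        · exact (h0 j hj).le
        · exact (hneg j hj).le
    · rw [if_neg hi, if_neg]
      intro h
      have := h (s i₀) (by simp)
      rw [h0 _ hi₀] at this
      exact absurd (hneg i hi) (not_lt.2 this)
  simp only [hval, ite_mul, zero_mul, Finset.sum_ite_mem, Finset.univ_inter, Finset.sum_div]
  exact Finset.sum_congr rfl fun i _ => by ring

theorem attend_ofFn {n : ℕ} {S : Finset (Fin n)} (hS : S.Nonempty) (h : AttentionHead)
    (hh : h.norm = hardmax) (X : Fin n → Vec) (x : Vec) (h0 : ∀ i ∈ S, h.score x (X i) = 0)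
    (hneg : ∀ i ∉ S, h.score x (X i) < 0) :
    h.attend (List.ofFn X) x = h.W.map fun r => (∑ i ∈ S, dot r (X i)) / S.card := by
  simp only [AttentionHead.attend, AttentionHead.pool, List.map_ofFn, List.length_ofFn, hh]
  refine List.map_congr_left fun r _ => ?_
  rw [Finset.sum_range, ← sum_hardmax_mul hS h0 hneg]
  refine Finset.sum_congr rfl fun i _ => ?_
  simp [Function.comp_def]

/-! ### The encoder of a vector addition system with zero tests -/

section Encoder

variable {k m : ℕ} (N : Net (Fin k) (Fin m))

def boolInt (b : Bool) : ℤ := if b then 1 else 0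

/-- The hidden layer of the first combination network: apart from the data on the position, it has
three ramps for each letter, whose combination with weights `1, -2, 1` is the indicator of that
letter. -/
def featureHidden (m n : ℕ) : List NeuronCode :=
  intNeuron 0 [n, 0, 0, 0, 0] :: intNeuron 0 [1, 0, 0, 0, 0] :: intNeuron 0 [0, 0, 1, 0, 0] ::
    ((List.ofFn fun a : Fin m => intNeuron (-a) [0, 0, 0, 0, 1]) ++
    ((List.ofFn fun a : Fin m => intNeuron (-a - 1) [0, 0, 0, 0, 1]) ++
    (List.ofFn fun a : Fin m => intNeuron (-a - 2) [0, 0, 0, 0, 1])))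

/-- The neuron that looks up the letter in the table `t`. -/
def tableNeuron (b c₀ c₁ c₂ : ℤ) (t : Fin m → ℤ) : NeuronCode :=
  intNeuron b (c₀ :: c₁ :: c₂ :: (List.ofFn t ++ ((List.ofFn fun a => -2 * t a) ++ List.ofFn t)))

/-- The hidden layer supplies `n` and `1` at position `0` and zeros elsewhere. Weighting them by
`input` and `init` adds the start marking to the effect of the first letter, without `n` occurring
in this layer. -/
def featureOutput : List NeuronCode :=
  tableNeuron (m := m) 1 0 0 0 (fun _ => 0) :: tableNeuron (m := m) 0 0 0 1 (fun _ => 0) ::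
    ((List.ofFn fun i => tableNeuron 0 (boolInt (N.input i)) (N.init i) 0 fun a => N.delta a i) ++
    (List.ofFn fun i => tableNeuron 0 0 0 0 fun a => boolInt (N.zero a i)))

/-- The initial values and the effects of the letters, as a function of the position. -/
def Net.effect (n p : ℕ) (a : Fin m) (i : Fin k) : ℤ :=
  (if p = 0 then N.start n i else 0) + N.delta a i

/-- The vectors after the first layer. -/
noncomputable def feature (n p : ℕ) (a : Fin m) : Vec :=
  1 :: (p : ℝ) :: ((List.ofFn fun i => (N.effect n p a i : ℝ)) ++
    List.ofFn fun i => (boolInt (N.zero a i) : ℝ))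

/-- The second difference of ramps is a hat function with peak at `a + 1` and support from `a` to `a
+ 2`, so it singles out one integer. -/
theorem ramps_eq (x a : ℤ) : relu (-a + x) - 2 * relu (-a - 1 + x) + relu (-a - 2 + x) =
    if x = a + 1 then 1 else 0 := by
  simp only [relu]
  rcases lt_trichotomy x (a + 1) with h | h | h
  · have h' : (x : ℝ) ≤ a := by exact_mod_cast Int.lt_add_one_iff.1 h
    rw [if_neg h.ne, max_eq_left (by linarith), max_eq_left (by linarith),
      max_eq_left (by linarith)]
    norm_num
  · subst h
    push_cast
    rw [if_pos rfl, max_eq_right (by linarith), max_eq_left (by linarith),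
      max_eq_left (by linarith)]
    ring
  · have h' : (a : ℝ) + 2 ≤ x := by exact_mod_cast (by omega : a + 2 ≤ x)
    rw [if_neg h.ne', max_eq_right (by linarith), max_eq_right (by linarith),
      max_eq_right (by linarith)]
    ring

theorem tableNeuron_eval (b c₀ c₁ c₂ : ℤ) (t : Fin m → ℤ) (x₀ x₁ x₂ : ℝ) (a : Fin m) :
    RatCode.val (tableNeuron b c₀ c₁ c₂ t).1 + dot (vecVal (tableNeuron b c₀ c₁ c₂ t).2)
      (x₀ :: x₁ :: x₂ :: ((List.ofFn fun j : Fin m => relu (-j + (a + 1))) ++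
        ((List.ofFn fun j : Fin m => relu (-j - 1 + (a + 1))) ++
        List.ofFn fun j : Fin m => relu (-j - 2 + (a + 1))))) =
    b + c₀ * x₀ + c₁ * x₁ + c₂ * x₂ + t a := by
  have hsum : ∑ j : Fin m, (t j : ℝ) * relu (-j + (a + 1)) +
      (∑ j : Fin m, (-2 * t j : ℝ) * relu (-j - 1 + (a + 1)) +
        ∑ j : Fin m, (t j : ℝ) * relu (-j - 2 + (a + 1))) = t a := by
    rw [← Finset.sum_add_distrib, ← Finset.sum_add_distrib]
    have : ∀ j : Fin m, (t j : ℝ) * relu (-j + (a + 1)) + ((-2 * t j : ℝ) *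
        relu (-j - 1 + (a + 1)) + (t j : ℝ) * relu (-j - 2 + (a + 1))) =
        if a = j then (t j : ℝ) else 0 := fun j => by
      have h := ramps_eq (a + 1) j
      push_cast at h
      have h' : ((a : ℤ) + 1 = j + 1) ↔ a = j := by rw [add_left_inj, Nat.cast_inj, Fin.ext_iff]
      simp only [h'] at h
      rw [← mul_boole, ← h]
      ring
    rw [Finset.sum_congr rfl fun j _ => this j]
    simp
  rw [tableNeuron, intNeuron_eval]
  simp only [List.map_cons, List.map_append, List.map_ofFn, Function.comp_def, dot_cons]
  rw [dot_append _ _ (by simp), dot_append _ _ (by simp), dot_ofFn, dot_ofFn, dot_ofFn]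
  push_cast
  rw [hsum]
  ring

theorem feature_eval (n p : ℕ) (a : Fin m) :
    fnnEval [featureHidden m n, featureOutput N] (sumEmb a p) = feature N n p a := by
  -- The three entries on the position are nonnegative, hence unchanged by the ReLU activation.
  have h1 : (affine (featureHidden m n) (sumEmb a p)).map relu =
      (if p = 0 then n else 0 : ℝ) :: (if p = 0 then 1 else 0 : ℝ) :: (p : ℝ) ::
      ((List.ofFn fun j : Fin m => relu (-j + (a + 1))) ++
        ((List.ofFn fun j : Fin m => relu (-j - 1 + (a + 1))) ++
        List.ofFn fun j : Fin m => relu (-j - 2 + (a + 1)))) := by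
    simp only [affine, featureHidden, List.map_cons, List.map_append, List.map_ofFn,
      Function.comp_def, intNeuron_eval]
    by_cases hp : p = 0
    · simp [sumEmb, hp, dot_cons, dot_nil, relu]
    · simp [sumEmb, hp, dot_cons, dot_nil, relu]
  rw [fnnEval, fnnEval, h1, featureOutput]
  simp only [affine, List.map_cons, List.map_append, List.map_ofFn, Function.comp_def,
    tableNeuron_eval, feature, Net.effect, Net.start]
  by_cases hp : p = 0
  · have : ∀ i, ((boolInt (N.input i) : ℤ) : ℝ) * n = if N.input i then (n : ℝ) else 0 := by
      intro i
      cases N.input i <;> simp [boolInt]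
    simp [hp, this, add_comm]
  · simp [hp]

/-! ### Second layer: prefix means by attention -/

def zeros (k : ℕ) : List ℤ := List.ofFn fun _ : Fin k => 0

/-- The `i`-th unit vector, multiplied by `c`. -/
def unitRow (c : ℤ) (i : Fin k) : List ℤ := List.ofFn fun j => if j = i then c else 0

theorem dot_zeros (f : Fin k → ℝ) :
    dot ((zeros k).map fun z : ℤ => (z : ℝ)) (List.ofFn f) = 0 := by
  simp only [zeros, List.map_ofFn, Function.comp_def, dot_ofFn]
  simp

theorem dot_unitRow (c : ℤ) (i : Fin k) (f : Fin k → ℝ) :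
    dot ((unitRow c i).map fun z : ℤ => (z : ℝ)) (List.ofFn f) = c * f i := by
  simp [unitRow, List.map_ofFn, Function.comp_def, dot_ofFn]

theorem length_zeros : (zeros k).length = k := by simp [zeros]

theorem length_unitRow (c : ℤ) (i : Fin k) : (unitRow c i).length = k := by simp [unitRow]

/-- The head that computes the means over all positions up to the current one. -/
def prefixHead (k : ℕ) : HeadCode :=
  (([intRow (0 :: 1 :: (zeros k ++ zeros k)), intRow (1 :: 0 :: (zeros k ++ zeros k))],
    [intRow (-1 :: 0 :: (zeros k ++ zeros k)), intRow (0 :: 1 :: (zeros k ++ zeros k))],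
    [[intNeuron 0 [1]], [intNeuron 0 [-1]]]),
    List.ofFn fun i : Fin k => intRow (0 :: 0 :: (unitRow 1 i ++ zeros k)))

theorem dot_intRow_feature (c₀ c₁ : ℤ) (l l' : List ℤ) (hl : l.length = k) (n p : ℕ) (a : Fin m) :
    dot (vecVal (intRow (c₀ :: c₁ :: (l ++ l')))) (feature N n p a) =
      c₀ + c₁ * p + dot (l.map fun z : ℤ => (z : ℝ)) (List.ofFn fun i => (N.effect n p a i : ℝ)) +
      dot (l'.map fun z : ℤ => (z : ℝ)) (List.ofFn fun i => (boolInt (N.zero a i) : ℝ)) := by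
  rw [vecVal_intRow, feature, List.map_cons, List.map_cons, List.map_append, dot_cons, dot_cons,
    dot_append _ _ (by simp [hl])]
  ring

/-- The two matrices extract `(p, 1)` and `(-1, q)`, whose scalar product is `q - p`. The score is
maximal exactly for `q ≤ p`. -/
theorem prefixHead_score (n p q : ℕ) (a b : Fin m) :
    (headVal (prefixHead k)).score (feature N n p a) (feature N n q b) =
      -relu (q - p) := by
  have hQ : mulVec (matVal (prefixHead k).1.1) (feature N n p a) = [(p : ℝ), 1] := by
    simp [mulVec, matVal, prefixHead, dot_intRow_feature, length_zeros, dot_zeros]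
  have hK : mulVec (matVal (prefixHead k).1.2.1) (feature N n q b) = [-1, (q : ℝ)] := by
    simp [mulVec, matVal, prefixHead, dot_intRow_feature, length_zeros, dot_zeros]
  simp only [headVal, hQ, hK]
  simp only [prefixHead, fnnEval, affine, List.map_cons, List.map_nil, intNeuron_eval, dot_cons,
    dot_nil, List.headD_cons]
  push_cast
  ring_nf

/-- The sum of the effects of the letters up to position `p`. -/
def Net.prefixSum {n : ℕ} (N : Net (Fin k) (Fin m)) (M : Fin k → ℤ) (v : Fin n → Fin m) (p : Fin n)
    (i : Fin k) : ℤ :=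
  M i + ∑ j, if j ≤ p then N.delta (v j) i else 0

/-- The start marking is part of the effect at position `0`, which belongs to every prefix. -/
theorem sum_effect {l : ℕ} (n : ℕ) (v : Fin l → Fin m) (p : Fin l) (i : Fin k) :
    ∑ j ∈ Finset.Iic p, N.effect n j (v j) i = N.prefixSum (N.start n) v p i := by
  have h0 : ∑ j ∈ Finset.Iic p, (if (j : ℕ) = 0 then N.start n i else 0) = N.start n i := by
    rw [Finset.sum_eq_single_of_mem (⟨0, p.pos⟩ : Fin l) (by simp [Fin.le_def])]
    · simp
    · intro j _ hj
      rw [if_neg fun h => hj (Fin.ext h)]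
  simp only [Net.effect, Net.prefixSum, Finset.sum_add_distrib, h0, ← Finset.sum_filter]
  congr 2
  ext j
  simp

theorem prefixHead_attend {l : ℕ} (n : ℕ) (v : Fin l → Fin m) (p : Fin l) :
    (headVal (prefixHead k)).attend (List.ofFn fun j : Fin l => feature N n j (v j))
      (feature N n p (v p)) =
    List.ofFn fun i : Fin k => (N.prefixSum (N.start n) v p i : ℝ) / ((p : ℝ) + 1) := by
  rw [attend_ofFn (S := Finset.Iic p) ⟨p, by simp⟩ _ rfl]
  · simp only [headVal, prefixHead, matVal, List.map_ofFn, Function.comp_def, dot_intRow_feature,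
      length_unitRow, dot_unitRow, dot_zeros, Fin.card_Iic]
    congr 1
    ext i
    rw [← sum_effect]
    push_cast
    congr 1
    exact Finset.sum_congr rfl fun j _ => by ring
  · intro j hj
    have : (j : ℝ) ≤ p := by exact_mod_cast Fin.le_def.1 (Finset.mem_Iic.1 hj)
    rw [prefixHead_score, relu, max_eq_left (by linarith), neg_zero]
  · intro j hj
    have : (p : ℝ) < j := by
      exact_mod_cast Fin.lt_def.1 (not_le.1 fun h => hj (Finset.mem_Iic.2 h))
    rw [prefixHead_score, relu, max_eq_right (by linarith)]
    linarith

/-! ### Second layer: penalties for violated conditions -/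

def errorHidden (k : ℕ) : List NeuronCode :=
  (List.ofFn fun i : Fin k =>
    intNeuron 0 (0 :: 0 :: ((zeros k ++ zeros k) ++ unitRow (-1) i))) ++
  ((List.ofFn fun i : Fin k =>
    intNeuron 0 (0 :: 0 :: ((zeros k ++ zeros k) ++ unitRow 1 i))) ++
  List.ofFn fun i : Fin k =>
    intNeuron 0 (0 :: 0 :: ((zeros k ++ unitRow (-1) i) ++ unitRow 1 i)))

/-- For the final counters `relu y` suffices, since negative values are already penalised by the
first output. -/
def errorOutput : List NeuronCode :=
  [intNeuron 0 ((List.ofFn fun _ : Fin k => 1) ++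
    ((List.ofFn fun _ : Fin k => 1) ++ List.ofFn fun _ : Fin k => -1)),
  intNeuron 0 (zeros k ++ ((List.ofFn fun i => boolInt (N.final i)) ++ zeros k))]

/-- Zero if `a` is nonnegative, and zero in case that `z` holds, and positive otherwise. -/
noncomputable def penalty (a : ℝ) (z : Bool) : ℝ :=
  relu (-a) + relu a - relu (a - boolInt z)

theorem error_eval (n p : ℕ) (a : Fin m) (y : Fin k → ℝ) :
    fnnEval [errorHidden k, errorOutput N] (feature N n p a ++ List.ofFn y) =
      [∑ i, penalty (y i) (N.zero a i), ∑ i, boolInt (N.final i) * relu (y i)] := by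
  have hrow : ∀ l₁ l₂ l₃ : List ℤ, l₁.length = k → l₂.length = k →
      dot ((0 :: 0 :: ((l₁ ++ l₂) ++ l₃)).map fun z : ℤ => (z : ℝ))
        (feature N n p a ++ List.ofFn y) =
      dot (l₁.map fun z : ℤ => (z : ℝ)) (List.ofFn fun i => (N.effect n p a i : ℝ)) +
      dot (l₂.map fun z : ℤ => (z : ℝ)) (List.ofFn fun i => (boolInt (N.zero a i) : ℝ)) +
      dot (l₃.map fun z : ℤ => (z : ℝ)) (List.ofFn y) := by
    intro l₁ l₂ l₃ h₁ h₂
    simp only [feature, List.map_cons, List.map_append, List.cons_append, dot_cons]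
    rw [dot_append _ _ (by simp [h₁, h₂]), dot_append _ _ (by simp [h₁])]
    push_cast
    ring
  have h1 : (affine (errorHidden k) (feature N n p a ++ List.ofFn y)).map relu =
      (List.ofFn fun i => relu (-y i)) ++ ((List.ofFn fun i => relu (y i)) ++
        List.ofFn fun i => relu (y i - boolInt (N.zero a i))) := by
    simp only [affine, errorHidden, List.map_append, List.map_ofFn, Function.comp_def,
      intNeuron_eval, hrow, length_zeros, length_unitRow, dot_zeros, dot_unitRow,
      Int.cast_neg, Int.cast_one, Int.cast_zero, neg_mul, one_mul, zero_add, neg_add_eq_sub]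
  rw [fnnEval, fnnEval, h1]
  simp only [affine, errorOutput, List.map_cons, List.map_nil, intNeuron_eval, List.map_append]
  rw [dot_append _ _ (by simp), dot_append _ _ (by simp), dot_append _ _ (by simp [length_zeros]),
    dot_append _ _ (by simp), dot_zeros, dot_zeros]
  simp only [List.map_ofFn, Function.comp_def, dot_ofFn, penalty, Finset.sum_add_distrib,
    Finset.sum_sub_distrib, Int.cast_neg, Int.cast_one, Int.cast_zero, neg_mul, one_mul, zero_add,
    add_zero, Finset.sum_neg_distrib, ← sub_eq_add_neg, add_sub_assoc]

/-- The head that computes the mean of the first coordinate over all positions. -/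
def meanHead : HeadCode := (([], [], [[intNeuron 0 [0]]]), [intRow [1, 0]])

/-- The matrices `Q` and `K` have no rows, and the scoring network is zero, so all positions are
maximal. -/
theorem meanHead_attend {l : ℕ} (f g : Fin (l + 1) → ℝ) (x : Vec) :
    (headVal meanHead).attend (List.ofFn fun j => [f j, g j]) x = [(∑ j, f j) / (l + 1)] := by
  rw [attend_ofFn (S := Finset.univ) Finset.univ_nonempty _ rfl]
  · simp [headVal, meanHead, matVal, vecVal_intRow, dot_cons, dot_nil]
  · intro j _
    simp [headVal, meanHead, fnnEval, affine, intNeuron_eval, mulVec, matVal, dot_cons, dot_nil]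
  · intro j hj
    exact absurd (Finset.mem_univ j) hj

/-- The code of the encoder for the input number `n`. -/
def Net.code (n : ℕ) : UdecCode :=
  (m, [([], [featureHidden m n, featureOutput N]),
    ([prefixHead k], [errorHidden k, errorOutput N]),
    ([meanHead], [[intNeuron 1 [0, -1, -1]]])], [[intNeuron 0 [1]]])

theorem Net.eval_code {l : ℕ} (n : ℕ) (v : Fin (l + 1) → Fin m) :
    (encoderVal (N.code n)).eval (List.ofFn v) =
      1 - (∑ i, boolInt (N.final i) *
        relu (N.prefixSum (N.start n) v (Fin.last l) i / ((l : ℝ) + 1))) -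
      (∑ p : Fin (l + 1), ∑ i, penalty (N.prefixSum (N.start n) v p i / ((p : ℝ) + 1))
        (N.zero (v p) i)) / ((l : ℝ) + 1) := by
  have h0 : (encoderVal (N.code n)).embed (List.ofFn v) =
      List.ofFn fun p : Fin (l + 1) => sumEmb (v p) p := by
    simp only [Encoder.embed]
    apply List.ext_getElem
    · rw [List.length_mapIdx]
      exact (List.length_ofFn (f := v)).trans List.length_ofFn.symm
    · intro i h1 h2
      rw [List.getElem_mapIdx, List.getElem_ofFn]
      exact congrArg (sumEmb · i) (List.getElem_ofFn (f := v) _)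
  have h1 : (layerVal ([], [featureHidden m n, featureOutput N])).apply
      (List.ofFn fun p : Fin (l + 1) => sumEmb (v p) p) =
      List.ofFn fun p : Fin (l + 1) => feature N n p (v p) := by
    simp [EncoderLayer.apply, layerVal, List.map_ofFn, Function.comp_def, feature_eval]
  have h2 : (layerVal ([prefixHead k], [errorHidden k, errorOutput N])).apply
      (List.ofFn fun p : Fin (l + 1) => feature N n p (v p)) =
      List.ofFn fun p : Fin (l + 1) =>
        [∑ i, penalty (N.prefixSum (N.start n) v p i / ((p : ℝ) + 1)) (N.zero (v p) i),
        ∑ i, boolInt (N.final i) * relu (N.prefixSum (N.start n) v p i / ((p : ℝ) + 1))] := by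
    simp only [EncoderLayer.apply, layerVal, List.map_ofFn, Function.comp_def, List.map_cons,
      List.map_nil, prefixHead_attend, List.flatten_cons, List.flatten_nil, List.append_nil,
      error_eval]
  have h3 : ∀ f g : Fin (l + 1) → ℝ, (layerVal ([meanHead], [[intNeuron 1 [0, -1, -1]]])).apply
      (List.ofFn fun p : Fin (l + 1) => [f p, g p]) =
      List.ofFn fun p => [1 - g p - (∑ j, f j) / (l + 1)] := by
    intro f g
    simp only [EncoderLayer.apply, layerVal, List.map_ofFn, Function.comp_def, List.map_cons,
      List.map_nil, meanHead_attend, List.flatten_cons, List.flatten_nil, List.append_nil,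
      List.cons_append, List.nil_append, fnnEval, affine, intNeuron_eval, dot_cons, dot_nil]
    refine congrArg List.ofFn (funext fun i => ?_)
    push_cast
    ring_nf
  have hlast : ∀ f : Fin (l + 1) → Vec, (List.ofFn f).getLastD [] = f (Fin.last l) := by
    intro f
    rw [List.getLastD_eq_getLast?, List.getLast?_eq_getElem?, List.length_ofFn,
      List.getElem?_ofFn]
    simp [Fin.last]
  rw [Encoder.eval, h0]
  simp only [encoderVal, Net.code, List.map_cons, List.map_nil, List.foldl_cons, List.foldl_nil,
    h1, h2, h3, hlast, fnnEval, affine, intNeuron_eval, dot_cons, dot_nil, List.headD_cons,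
    Fin.val_last]
  push_cast
  ring

/-! ### The value is one exactly on successful runs -/

theorem relu_nonneg (x : ℝ) : 0 ≤ relu x := le_max_left _ _

theorem penalty_nonneg (a : ℝ) (z : Bool) : 0 ≤ penalty a z := by
  have h1 := relu_nonneg (-a)
  have h2 : relu (a - boolInt z) ≤ relu a :=
    max_le_max le_rfl (by cases z <;> simp [boolInt])
  rw [penalty]
  linarith

/-- For `a ≥ 0` and `z` true the penalty is `min a 1`. Shifting a ramp by the bit `z` switches the
test on and off without a product, and no lower bound on the nonzero means is needed. -/
theorem penalty_eq_zero_iff (a : ℝ) (z : Bool) :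
    penalty a z = 0 ↔ 0 ≤ a ∧ (z → a = 0) := by
  simp only [penalty, relu]
  rcases lt_trichotomy a 0 with h | rfl | h
  · have hz : a - boolInt z ≤ 0 := by cases z <;> simp [boolInt] <;> linarith
    rw [max_eq_right (by linarith), max_eq_left h.le, max_eq_left hz]
    exact ⟨fun h' => by linarith, fun h' => by linarith [h'.1]⟩
  · cases z <;> simp [boolInt]
  · cases z
    · simp [boolInt, h.le]
    · have hlt : max 0 (a - 1) < a := max_lt h (by linarith)
      rw [max_eq_left (by linarith : -a ≤ 0), max_eq_right h.le]
      simp only [boolInt, if_true, Int.cast_one]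
      exact ⟨fun h' => by linarith, fun h' => by linarith [h'.2 trivial]⟩

theorem Net.valid_ofFn {l : ℕ} (M : Fin k → ℤ) (v : Fin l → Fin m) :
    N.Valid M (List.ofFn v) ↔
      (∀ p i, 0 ≤ N.prefixSum M v p i ∧ (N.zero (v p) i → N.prefixSum M v p i = 0)) ∧
      ∀ i, N.final i → M i + ∑ j, N.delta (v j) i = 0 := by
  induction l generalizing M with
  | zero => simp [Net.Valid]
  | succ l ih =>
    rw [List.ofFn_succ, Net.Valid, ih, Fin.forall_fin_succ, and_assoc]
    simp only [Net.prefixSum, Fin.sum_univ_succ, Fin.succ_le_succ_iff, Fin.zero_le, if_true,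
      Fin.le_zero_iff, Fin.succ_ne_zero, if_false, Finset.sum_const_zero, add_zero, add_assoc]

theorem Net.eval_code_eq_one_iff {l : ℕ} (n : ℕ) (v : Fin (l + 1) → Fin m) :
    (encoderVal (N.code n)).eval (List.ofFn v) = 1 ↔ N.Valid (N.start n) (List.ofFn v) := by
  rw [Net.eval_code, Net.valid_ofFn]
  have hpos : ∀ p : ℕ, (0 : ℝ) < p + 1 := fun p => by positivity
  have hnn : ∀ i : Fin k, (0 : ℝ) ≤ boolInt (N.final i) *
      relu (N.prefixSum (N.start n) v (Fin.last l) i / ((l : ℝ) + 1)) := fun i =>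
    mul_nonneg (by cases N.final i <;> simp [boolInt]) (relu_nonneg _)
  have hp : ∀ p : Fin (l + 1), 0 ≤ ∑ i, penalty
      (N.prefixSum (N.start n) v p i / ((p : ℝ) + 1)) (N.zero (v p) i) := fun p =>
    Finset.sum_nonneg fun i _ => penalty_nonneg _ _
  have hA := Finset.sum_nonneg fun i (_ : i ∈ Finset.univ) => hnn i
  have hB := Finset.sum_nonneg fun p (_ : p ∈ Finset.univ) => hp p
  have hlast : ∀ i, N.start n i + ∑ j, N.delta (v j) i =
      N.prefixSum (N.start n) v (Fin.last l) i := fun i => by simp [Net.prefixSum, Fin.le_last]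
  have hstep : ∀ A B : ℝ, 0 ≤ A → 0 ≤ B → (1 - A - B / (l + 1) = 1 ↔ B = 0 ∧ A = 0) := by
    intro A B hA hB
    have hd := div_nonneg hB (hpos l).le
    constructor
    · intro h
      have h' : B / (l + 1) = 0 := by linarith
      rw [div_eq_zero_iff] at h'
      exact ⟨h'.resolve_right (hpos l).ne', by linarith⟩
    · rintro ⟨rfl, rfl⟩
      simp
  rw [hstep _ _ hA hB, Finset.sum_eq_zero_iff_of_nonneg fun p _ => hp p,
    Finset.sum_eq_zero_iff_of_nonneg fun i _ => hnn i]
  simp only [Finset.mem_univ, true_imp_iff, hlast,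
    Finset.sum_eq_zero_iff_of_nonneg fun i _ => penalty_nonneg _ _, penalty_eq_zero_iff,
    le_div_iff₀ (hpos _), zero_mul, div_eq_zero_iff, (hpos _).ne', or_false, Int.cast_nonneg_iff,
    Int.cast_eq_zero]
  refine and_congr_right fun hv => forall_congr' fun i => ?_
  -- At this point the prefix conditions hold, so `relu` acts as the identity on the last mean.
  have h0 : (0 : ℝ) ≤ N.prefixSum (N.start n) v (Fin.last l) i := by
    exact_mod_cast (hv (Fin.last l) i).1
  rw [relu, max_eq_right (div_nonneg h0 (hpos l).le)]
  cases N.final i <;> simp [boolInt, (hpos l).ne']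

/-! ### Dimensions and computability of the code -/

theorem Net.code_wf (hm : 0 < m) (n : ℕ) : UdecWF (N.code n) := by
  -- The dimensions run through `5`, `2 + k + k`, `2` and `1`.
  refine ⟨hm, 1, ⟨by simp, 2 + k + k, ?_, ?_, 2, ?_, ?_, 1, ?_, rfl⟩, ?_⟩
  · refine ⟨?_, ?_, ?_⟩
    · simp only [featureHidden, List.mem_cons, List.mem_append, List.mem_ofFn]
      rintro v (rfl | rfl | rfl | ⟨a, rfl⟩ | ⟨a, rfl⟩ | ⟨a, rfl⟩) <;> simp [length_intNeuron]
    · simp only [featureOutput, List.mem_cons, List.mem_append, List.mem_ofFn, featureHidden]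
      rintro v (rfl | rfl | ⟨a, rfl⟩ | ⟨a, rfl⟩) <;> simp [tableNeuron, length_intNeuron]
    · simp [featureOutput]
      omega
  · simp only [List.mem_singleton, forall_eq]
    refine ⟨⟨2, ⟨rfl, ?_⟩, ⟨rfl, ?_⟩⟩, ?_, ⟨rfl, ?_⟩⟩
    · simp [prefixHead, length_intRow, length_zeros]
      omega
    · simp [prefixHead, length_intRow, length_zeros]
      omega
    · simp [prefixHead, FNNWF, length_intNeuron]
    · simp only [prefixHead, List.mem_ofFn]
      rintro r ⟨i, rfl⟩
      simp [length_intRow, length_zeros, length_unitRow]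
      omega
  · refine ⟨?_, ?_, ?_⟩
    · simp only [errorHidden, List.mem_append, List.mem_ofFn]
      rintro v (⟨a, rfl⟩ | ⟨a, rfl⟩ | ⟨a, rfl⟩) <;>
        simp [length_intNeuron, length_zeros, length_unitRow, prefixHead] <;> omega
    · simp only [errorOutput, List.mem_cons, List.not_mem_nil, or_false]
      rintro v (rfl | rfl) <;> simp [length_intNeuron, length_zeros, errorHidden]
    · simp [errorOutput]
  · simp only [List.mem_singleton, forall_eq]
    refine ⟨⟨0, ⟨rfl, ?_⟩, ⟨rfl, ?_⟩⟩, ?_, ⟨rfl, ?_⟩⟩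
    · exact fun r hr => absurd hr List.not_mem_nil
    · exact fun r hr => absurd hr List.not_mem_nil
    · simp [meanHead, FNNWF, length_intNeuron]
    · simp [meanHead, length_intRow]
  · simp [FNNWF, length_intNeuron, meanHead]
  · change FNNWF 1 [[intNeuron 0 [1]]] 1
    simp [FNNWF, length_intNeuron]

theorem Net.satisfiable_code (n : ℕ) :
    (encoderVal (N.code n)).Satisfiable ↔ N.Accepts n := by
  have key : ∀ w : List (Fin m), w ≠ [] →
      ((encoderVal (N.code n)).eval w = 1 ↔ N.Valid (N.start n) w) := by
    intro w hw
    obtain ⟨l, hl⟩ := Nat.exists_eq_succ_of_ne_zero fun h => hw (List.length_eq_zero_iff.1 h)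
    obtain ⟨v, rfl⟩ : ∃ v : Fin (l + 1) → Fin m, w = List.ofFn v :=
      ⟨fun i => w[(i : ℕ)], 
        List.ext_getElem (by rw [List.length_ofFn, hl]) fun i _ _ => by rw [List.getElem_ofFn]⟩
    exact N.eval_code_eq_one_iff n v
  exact exists_congr fun w => and_congr_right (key w)

theorem primrec_intCast : Primrec fun n : ℕ => (n : ℤ) := by
  -- The standard coding of the integers sends a natural number `n` to `2 * n`.
  refine Primrec.encode_iff.1 ((Primrec.nat_mul.comp (Primrec.const 2) Primrec.id).of_eq ?_)
  intro n
  rfl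

theorem Net.primrec_code : Primrec N.code := by
  have hn : Primrec fun n : ℕ => intNeuron 0 [n, 0, 0, 0, 0] :=
    .pair (.const _) (Primrec.list_cons.comp (.pair primrec_intCast (.const 0)) (.const _))
  have hl : Primrec (featureHidden m) := Primrec.list_cons.comp hn (.const _)
  have hc : Primrec fun n => (([], [featureHidden m n, featureOutput N]) : LayerCode) :=
    .pair (.const _) (Primrec.list_cons.comp hl (.const _))
  exact .pair (.const _) (.pair (Primrec.list_cons.comp hc (.const _)) (.const _))

end Encoder

/-- The halting problem reduces to the satisfiability problem. -/
theorem exists_reduction {f : ℕ →. ℕ} (hf : Partrec f) : ∃ g : ℕ → UdecCode, Computable g ∧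
    ∀ n, UdecWF (g n) ∧ ((encoderVal (g n)).Satisfiable ↔ (f n).Dom) := by
  obtain ⟨p, hp⟩ := exists_prog_of_partrec hf
  obtain ⟨k, m, N, hm, hN⟩ := exists_net_of_prog p
  exact ⟨N.code, N.primrec_code.to_comp, fun n =>
    ⟨N.code_wf hm n, by rw [N.satisfiable_code, hp, hN]⟩⟩

end TE

theorem theorem1 :
    ¬ ∃ f : TE.UdecCode → Bool, Computable f ∧
      ∀ c : TE.UdecCode, TE.UdecWF c → (f c = true ↔ (TE.encoderVal c).Satisfiable) := by
  rintro ⟨f, hf, hfc⟩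
  -- The reduction is applied to the function that runs the program with a given number on input
  -- `0`; a decision procedure for satisfiability would then decide halting on `0`.
  have heval : Partrec fun n : ℕ => (Denumerable.ofNat Nat.Partrec.Code n).eval 0 :=
    Nat.Partrec.Code.eval_part.comp (Computable.ofNat _) (Computable.const 0)
  obtain ⟨g, hg, hgc⟩ := TE.exists_reduction heval
  refine ComputablePred.halting_problem 0 (ComputablePred.computable_iff.2
    ⟨fun c => f (g (Encodable.encode c)), hf.comp (hg.comp Computable.encode), ?_⟩)
  ext c
  obtain ⟨hwf, hsat⟩ := hgc (Encodable.encode c)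
  rw [hfc _ hwf, hsat, Denumerable.ofNat_encode]
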